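/- Let $\Lambda=\mathbb C[\mathbf p_1,\mathbf p_2,\dots]$ be the algebra of symmetric functions, generated by the power sums $\mathbf p_k$, with the generating series in $\frac1u$ $$H(u)=1+\sum_{k\ge1}\frac{h_k}{u^k}=\exp\Big(\sum_{k\ge1}\frac{\mathbf p_k}{k\,u^k}\Big),\qquad E(u)=1+\sum_{k\ge1}\frac{e_k}{u^k}=\exp\Big(\sum_{k\ge1}\frac{(-1)^{k-1}\mathbf p_k}{k\,u^k}\Big).$$ Write $y^{\downarrow m}=y(y-1)\cdots(y-m+1)$. Let $\Lambda^*$ be the algebra of shifted symmetric functions: the projective limit, in the category of filtered algebras, of the algebras of polynomials in $x_1,\dots,x_n$ over $\mathbb C$ symmetric in the variables $x_i-i$, with projections $x_n=0$. For a Young diagram $\mu$ let $s^*_\mu\in\Lambda^*$ be the shifted Schur function, given by $$s^*_\mu(x_1,\dots,x_n)=\frac{\det\big[(x_i+n-i)^{\downarrow(\mu_j+n-j)}\big]_{i,j=1}^n}{\det\big[(x_i+n-i)^{\downarrow(n-j)}\big]_{i,j=1}^n}\qquad(n\ge\ell(\mu)),$$ and put $H^*(u)=1+\sum_{k\ge1}s^*_{(k)}/u^{\downarrow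 k}$. There is a unique algebra isomorphism $\varphi:\Lambda^*\to\Lambda$ such that, applied coefficientwise, $\varphi(H^*(u))=H(u+\tfrac12)$. Define the Frobenius–Schur functions by $Fs_\mu=\varphi(s^*_\mu)\in\Lambda$, and for $p,q\ge0$ let $(p\,|\,q)$ be the hook Young diagram $(p+1,1^q)$. **Theorem 2.3.** As series in $\frac1u,\frac1v$ with coefficients in $\Lambda$, $$1+(u+v)\sum_{p,q=0}^\infty\frac{Fs_{(p\,|\,q)}}{(u-\tfrac12)(u-\tfrac32)\cdots(u-\tfrac{2p+1}2)\,(v-\tfrac12)(v-\tfrac32)\cdots(v-\tfrac{2q+1}2)}=H(u)E(v).$$ Equivalently, for all $p,q=0,1,2,\dots$, $$Fs_{(p+1\,|\,q)}+Fs_{(p\,|\,q+1)}+(p+q+1)\,Fs_{(p\,|\,q)}=Fs_{(p\,|\,0)}\,Fs_{(0\,|\,q)}.$$ -/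

import Mathlib

/-!
# Frobenius–Schur functions

Formal series in `1/u` are power series whose variable is `1/u`.
Indices in `Fin n` start at `0`; the variable called `x_i` in the comments, with `1 ≤ i ≤ n`, is
`X (i - 1)`.

The definitions used in the main statement are `ShiftedSym` (the algebra `Λ*`), `fall`,
`alternant`, `ratio`, `shiftedSchur` (the functions `s*_μ`), `Lam` (the algebra `Λ`), `formalSum`,
`invLin`, `invFall`, `rowDiagram`, `hStar`, `HStar` (the series `H*(u)`), `H`, `E`, `translate`,
`phi` (the isomorphism `φ`), `Fs`, `hook`, `invHalf`, `Lam2`, `atU`, `atV`, `formalSum2`,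
`hookSeries`, `Laurent2`, `incl`, `u`, `v`. Everything else is auxiliary: it serves to prove that
the ratio of determinants is a polynomial, that `s*_μ` lies in `Λ*`, and that `φ` exists and is
unique.
-/

namespace FrobeniusSchur

open MvPolynomial

/-! ### Shifted symmetric functions -/

/-- The change of variables `x_i ↦ x_i - i` (1-based `i`) on `ℂ[x₁,…,xₙ]`. -/
noncomputable def shift (n : ℕ) : MvPolynomial (Fin n) ℂ →ₐ[ℂ] MvPolynomial (Fin n) ℂ :=
  aeval fun i => X i - C ((i : ℂ) + 1)

/-- `Λ*ₙ`: polynomials in `x₁,…,xₙ` that are symmetric in the variables `x_i - i`. -/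
noncomputable def shiftedSymLevel (n : ℕ) : Subalgebra ℂ (MvPolynomial (Fin n) ℂ) :=
  (symmetricSubalgebra (Fin n) ℂ).map (shift n)

/-- The specialization `x_{n+1} = 0`. -/
noncomputable def proj (n : ℕ) : MvPolynomial (Fin (n + 1)) ℂ →ₐ[ℂ] MvPolynomial (Fin n) ℂ :=
  aeval (Fin.lastCases 0 X)

/-- The algebra `Λ*` of shifted symmetric functions: the projective limit, in the category of
filtered algebras, of the algebras `Λ*ₙ`, i.e. compatible sequences of bounded degree. -/
noncomputable def ShiftedSym : Subalgebra ℂ (∀ n : ℕ, MvPolynomial (Fin n) ℂ) where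
  carrier := {f | (∀ n, f n ∈ shiftedSymLevel n) ∧ (∀ n, proj n (f (n + 1)) = f n) ∧
    ∃ d : ℕ, ∀ n, (f n).totalDegree ≤ d}
  mul_mem' := by
    rintro f g ⟨hf1, hf2, d, hd⟩ ⟨hg1, hg2, e, he⟩
    refine ⟨fun n => mul_mem (hf1 n) (hg1 n), fun n => ?_, d + e, fun n => ?_⟩
    · simp [hf2, hg2]
    · exact (totalDegree_mul _ _).trans (add_le_add (hd n) (he n))
  add_mem' := by
    rintro f g ⟨hf1, hf2, d, hd⟩ ⟨hg1, hg2, e, he⟩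
    refine ⟨fun n => add_mem (hf1 n) (hg1 n), fun n => ?_, max d e, fun n => ?_⟩
    · simp [hf2, hg2]
    · exact (totalDegree_add _ _).trans (max_le_max (hd n) (he n))
  algebraMap_mem' := by
    intro r
    refine ⟨fun n => Subalgebra.algebraMap_mem _ r, fun n => ?_, 0, fun n => ?_⟩
    · simp [algebraMap_eq]
    · simp [algebraMap_eq]

/-! ### Shifted Schur functions -/

/-- The falling factorial power `y (y - 1) ⋯ (y - m + 1)`. -/
def fall {R : Type*} [CommRing R] (y : R) (m : ℕ) : R := ∏ k ∈ Finset.range m, (y - k)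

/-- The determinant `det[(x_i + n - i)^{↓ (m_j + n - j)}]` of order `n` (1-based `i`, `j`), for a
sequence of natural numbers `m₁, m₂, …` (with `m j = m_{j+1}`). -/
noncomputable def alternant (n : ℕ) (m : ℕ → ℕ) : MvPolynomial (Fin n) ℂ :=
  Matrix.det (Matrix.of fun i j : Fin n =>
    fall (X i + C ((n : ℂ) - ((i : ℂ) + 1))) (m j + (n - (j + 1))))

section Determinants

/-- `y (y - 1) ⋯ (y - m + 1)` as a polynomial in `y`. -/
noncomputable def fallPoly (R : Type*) [CommRing R] (m : ℕ) : Polynomial R :=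
  ∏ k ∈ Finset.range m, (Polynomial.X - Polynomial.C (k : R))

theorem fallPoly_eval {R : Type*} [CommRing R] (y : R) (m : ℕ) :
    (fallPoly R m).eval y = fall y m := by
  simp [fallPoly, fall, Polynomial.eval_prod]

theorem fallPoly_map {R S : Type*} [CommRing R] [CommRing S] (f : R →+* S) (m : ℕ) :
    (fallPoly R m).map f = fallPoly S m := by
  simp [fallPoly, Polynomial.map_prod]

theorem fallPoly_monic (R : Type*) [CommRing R] (m : ℕ) : (fallPoly R m).Monic :=
  Polynomial.monic_prod_of_monic _ _ fun _ _ => Polynomial.monic_X_sub_C _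

theorem fallPoly_natDegree (R : Type*) [CommRing R] [Nontrivial R] (m : ℕ) :
    (fallPoly R m).natDegree = m := by
  rw [fallPoly, Polynomial.natDegree_prod_of_monic _ _ fun _ _ => Polynomial.monic_X_sub_C _]
  simp only [Polynomial.natDegree_X_sub_C, Finset.sum_const, Finset.card_range, smul_eq_mul, mul_one]

theorem map_fall {R S : Type*} [CommRing R] [CommRing S] (f : R →+* S) (y : R) (m : ℕ) :
    f (fall y m) = fall (f y) m := by
  simp [fall, map_prod]

/-- The Vandermonde determinant `det[v_i^{n-j}]`. -/
noncomputable def vdm {R : Type*} [CommRing R] {n : ℕ} (v : Fin n → R) : R :=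
  Matrix.det (Matrix.of fun i j : Fin n => v i ^ (n - (j + 1)))

theorem eval_eq_sum_rev {R : Type*} [CommRing R] {n : ℕ} (p : Polynomial R) (hp : p.degree < n)
    (y : R) : p.eval y = ∑ k : Fin n, y ^ (n - (k + 1)) * p.coeff (n - (k + 1)) := by
  rw [Polynomial.eval_eq_sum, Polynomial.sum_eq_of_subset (s := Finset.range n)]
  · rw [← Finset.sum_range_reflect, Finset.sum_range]
    refine Finset.sum_congr rfl fun k _ => ?_
    have : n - 1 - (k : ℕ) = n - (k + 1) := by omega
    rw [this, mul_comm]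
  · simp
  · intro k hk
    rw [Finset.mem_range]
    have := Polynomial.le_degree_of_mem_supp k hk
    exact_mod_cast this.trans_lt hp

theorem det_eval {R : Type*} [CommRing R] {n : ℕ} (v : Fin n → R) (p : Fin n → Polynomial R)
    (hp : ∀ j, (p j).degree < n) :
    Matrix.det (Matrix.of fun i j : Fin n => (p j).eval (v i)) =
      vdm v * Matrix.det (Matrix.of fun k j : Fin n => (p j).coeff (n - (k + 1))) := by
  rw [vdm, ← Matrix.det_mul]
  congr 1
  ext i j
  simp only [Matrix.mul_apply, Matrix.of_apply]
  exact eval_eq_sum_rev _ (hp j) _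

theorem det_eval_triangular {R : Type*} [CommRing R] {n : ℕ} (v : Fin n → R)
    (p : Fin n → Polynomial R) (hp : ∀ j, (p j).natDegree ≤ n - (j + 1)) :
    Matrix.det (Matrix.of fun i j : Fin n => (p j).eval (v i)) =
      vdm v * ∏ j : Fin n, (p j).coeff (n - (j + 1)) := by
  rw [det_eval]
  · rw [Matrix.det_of_isLowerTriangular]
    · rfl
    · intro k j hkj
      have hkj : k < j := hkj
      apply Polynomial.coeff_eq_zero_of_natDegree_lt
      have := hp j
      have h2 : (k : ℕ) < j := hkj
      omega
  · intro j
    refine (Polynomial.degree_le_of_natDegree_le (hp j)).trans_lt ?_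
    have := j.2
    exact_mod_cast (by omega : n - ((j : ℕ) + 1) < n)

/-- The monic polynomial with roots `v_i`. -/
noncomputable def nodal {R : Type*} [CommRing R] {n : ℕ} (v : Fin n → R) : Polynomial R :=
  ∏ i, (Polynomial.X - Polynomial.C (v i))

theorem nodal_monic {R : Type*} [CommRing R] {n : ℕ} (v : Fin n → R) : (nodal v).Monic :=
  Polynomial.monic_prod_of_monic _ _ fun _ _ => Polynomial.monic_X_sub_C _

theorem nodal_degree {R : Type*} [CommRing R] [Nontrivial R] {n : ℕ} (v : Fin n → R) :
    (nodal v).degree = n := by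
  rw [Polynomial.degree_eq_natDegree (nodal_monic v).ne_zero, nodal,
    Polynomial.natDegree_prod_of_monic _ _ fun _ _ => Polynomial.monic_X_sub_C _]
  simp

theorem nodal_eval {R : Type*} [CommRing R] {n : ℕ} (v : Fin n → R) (i : Fin n) :
    (nodal v).eval (v i) = 0 := by
  rw [nodal, Polynomial.eval_prod]
  exact Finset.prod_eq_zero (Finset.mem_univ i) (by simp)

/-- The quotient of `det[p_j(v_i)]` by the Vandermonde determinant. -/
noncomputable def quot {R : Type*} [CommRing R] {n : ℕ} (v : Fin n → R)
    (p : Fin n → Polynomial R) : R :=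
  Matrix.det (Matrix.of fun k j : Fin n => (p j %ₘ nodal v).coeff (n - (k + 1)))

theorem det_eval_quot {R : Type*} [CommRing R] [Nontrivial R] {n : ℕ} (v : Fin n → R)
    (p : Fin n → Polynomial R) :
    Matrix.det (Matrix.of fun i j : Fin n => (p j).eval (v i)) = vdm v * quot v p := by
  rw [quot, ← det_eval]
  · congr 1
    ext i j
    simp only [Matrix.of_apply]
    conv_lhs => rw [← Polynomial.modByMonic_add_div (p j) (nodal v)]
    simp [nodal_eval]
  · intro j
    rw [← nodal_degree v]
    exact Polynomial.degree_modByMonic_lt _ (nodal_monic v)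

theorem map_quot {R S : Type*} [CommRing R] [CommRing S] (f : R →+* S) {n : ℕ} (v : Fin n → R)
    (p : Fin n → Polynomial R) :
    f (quot v p) = quot (fun i => f (v i)) (fun j => (p j).map f) := by
  have h : (nodal v).map f = nodal fun i => f (v i) := by simp [nodal, Polynomial.map_prod]
  rw [quot, RingHom.map_det, quot]
  congr 1
  ext k j
  simp only [RingHom.mapMatrix_apply, Matrix.map_apply, Matrix.of_apply]
  rw [← h, ← Polynomial.map_modByMonic _ (nodal_monic v), Polynomial.coeff_map]

end Determinants

/-- The variables `x_i + n - i`. -/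
noncomputable def yvar (n : ℕ) (i : Fin n) : MvPolynomial (Fin n) ℂ :=
  X i + C ((n : ℂ) - ((i : ℂ) + 1))

theorem alternant_eq (n : ℕ) (m : ℕ → ℕ) :
    alternant n m = vdm (yvar n) *
      quot (yvar n) (fun j => fallPoly _ (m j + (n - (j + 1)))) := by
  rw [← det_eval_quot]
  simp only [fallPoly_eval]
  rfl

theorem alternant_zero_eq (n : ℕ) : alternant n (fun _ => 0) = vdm (yvar n) := by
  have := det_eval_triangular (yvar n) (fun j => fallPoly _ (n - (j + 1)))
    (fun j => (fallPoly_natDegree _ _).le)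
  have h2 : ∀ m, (fallPoly (MvPolynomial (Fin n) ℂ) m).coeff m = 1 := fun m => by
    have := fallPoly_monic (MvPolynomial (Fin n) ℂ) m
    rw [Polynomial.Monic, Polynomial.leadingCoeff, fallPoly_natDegree] at this
    exact this
  simp only [h2, Finset.prod_const_one, mul_one, fallPoly_eval] at this
  simp only [alternant, zero_add]
  exact this

theorem vdm_eq_prod {R : Type*} [CommRing R] {n : ℕ} (v : Fin n → R) :
    ∃ e : ℤˣ, vdm v = ((e : ℤ) : R) * ∏ i : Fin n, ∏ j ∈ Finset.Ioi i, (v j - v i) := by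
  refine ⟨Equiv.Perm.sign (Fin.revPerm (n := n)), ?_⟩
  rw [← Matrix.det_vandermonde, ← Matrix.det_permute', vdm]
  congr 1

theorem alternant_zero_degree (n : ℕ) :
    alternant n (fun _ => 0) ≠ 0 ∧
      ∑ j : Fin n, (n - (j + 1)) ≤ (alternant n (fun _ => 0)).totalDegree := by
  have hlin : ∀ i j : Fin n, i < j → (yvar n j - yvar n i) ≠ 0 ∧
      1 ≤ (yvar n j - yvar n i).totalDegree := by
    intro i j hij
    have hc : coeff (Finsupp.single j 1) (yvar n j - yvar n i) = 1 := by
      have hne : (Finsupp.single i 1 : Fin n →₀ ℕ) ≠ Finsupp.single j 1 := by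
        intro h
        exact hij.ne (Finsupp.single_left_injective one_ne_zero h)
      have h0 : (0 : Fin n →₀ ℕ) ≠ Finsupp.single j 1 := by
        intro h
        have := DFunLike.congr_fun h j
        simp at this
      have h1 : yvar n j - yvar n i =
          X j - X i + C (((n : ℂ) - ((j : ℂ) + 1)) - ((n : ℂ) - ((i : ℂ) + 1))) := by
        rw [map_sub, yvar, yvar]; ring
      rw [h1]
      generalize ((n : ℂ) - ((j : ℂ) + 1)) - ((n : ℂ) - ((i : ℂ) + 1)) = c
      simp [coeff_X, coeff_C, hne, h0]
    have hs : Finsupp.single j 1 ∈ (yvar n j - yvar n i).support := by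
      rw [mem_support_iff, hc]; exact one_ne_zero
    refine ⟨fun h => by simp [h] at hc, ?_⟩
    have := le_totalDegree hs
    simpa using this
  have hprod : ∀ (s : Finset (Fin n)) (g : Fin n → MvPolynomial (Fin n) ℂ) (w : Fin n → ℕ),
      (∀ i ∈ s, g i ≠ 0 ∧ w i ≤ (g i).totalDegree) →
      (∏ i ∈ s, g i) ≠ 0 ∧ ∑ i ∈ s, w i ≤ (∏ i ∈ s, g i).totalDegree := by
    intro s g w
    induction s using Finset.induction_on with
    | empty => simp
    | insert a s ha ih =>
      intro h
      obtain ⟨h1, h2⟩ := ih fun i hi => h i (Finset.mem_insert_of_mem hi)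
      obtain ⟨h3, h4⟩ := h a (Finset.mem_insert_self a s)
      rw [Finset.prod_insert ha, Finset.sum_insert ha, totalDegree_mul_of_isDomain h3 h1]
      exact ⟨mul_ne_zero h3 h1, add_le_add h4 h2⟩
  obtain ⟨e, he⟩ := vdm_eq_prod (yvar n)
  obtain ⟨h1, h2⟩ := hprod Finset.univ (fun i => ∏ j ∈ Finset.Ioi i, (yvar n j - yvar n i))
    (fun i => n - (i + 1)) (fun i _ => by
      obtain ⟨h1, h2⟩ := hprod (Finset.Ioi i) (fun j => yvar n j - yvar n i) (fun _ => 1)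
        (fun j hj => hlin i j (Finset.mem_Ioi.1 hj))
      refine ⟨h1, le_trans ?_ h2⟩
      simp [Fin.card_Ioi]
      omega)
  rw [alternant_zero_eq, he]
  rcases Int.units_eq_one_or e with rfl | rfl
  · simpa using ⟨h1, h2⟩
  · simpa using ⟨h1, h2⟩

theorem alternant_degree_le (n : ℕ) (m : ℕ → ℕ) :
    (alternant n m).totalDegree ≤ ∑ j : Fin n, (m j + (n - (j + 1))) := by
  have hlin : ∀ (i : Fin n) (k : ℕ),
      (fall (X i + C ((n : ℂ) - ((i : ℂ) + 1)) : MvPolynomial (Fin n) ℂ) k).totalDegree ≤ k := by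
    intro i k
    rw [fall]
    refine (totalDegree_finsetProd _ _).trans ?_
    refine (Finset.sum_le_card_nsmul _ _ 1 fun l _ => ?_).trans (by simp)
    have : (X i + C ((n : ℂ) - ((i : ℂ) + 1)) - (l : MvPolynomial (Fin n) ℂ)) =
        X i + C ((n : ℂ) - ((i : ℂ) + 1) - l) := by
      simp [map_sub]; ring
    rw [this]
    refine (totalDegree_add _ _).trans ?_
    rw [totalDegree_X, totalDegree_C]
    simp
  rw [alternant, Matrix.det_apply]
  refine totalDegree_finsetSum_le fun σ _ => ?_
  refine (totalDegree_smul_le _ _).trans ?_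
  refine (totalDegree_finsetProd _ _).trans ?_
  exact Finset.sum_le_sum fun j _ => hlin _ _

theorem exists_ratio (n : ℕ) (m : ℕ → ℕ) :
    ∃ q : MvPolynomial (Fin n) ℂ, q * alternant n (fun _ => 0) = alternant n m :=
  ⟨quot (yvar n) (fun j => fallPoly _ (m j + (n - (j + 1)))), by
    rw [alternant_eq n m, alternant_zero_eq, mul_comm]⟩

/-- The polynomial `det[(x_i + n - i)^{↓(m_j + n - j)}] / det[(x_i + n - i)^{↓(n - j)}]`. -/
noncomputable def ratio (n : ℕ) (m : ℕ → ℕ) : MvPolynomial (Fin n) ℂ :=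
  (exists_ratio n m).choose

theorem ratio_mul (n : ℕ) (m : ℕ → ℕ) :
    ratio n m * alternant n (fun _ => 0) = alternant n m :=
  (exists_ratio n m).choose_spec

theorem ratio_eq_quot (n : ℕ) (m : ℕ → ℕ) :
    ratio n m = quot (yvar n) (fun j => fallPoly _ (m j + (n - (j + 1)))) := by
  apply mul_right_cancel₀ (alternant_zero_degree n).1
  rw [ratio_mul, alternant_eq n m, alternant_zero_eq, mul_comm]

theorem ratio_mem (n : ℕ) (m : ℕ → ℕ) : ratio n m ∈ shiftedSymLevel n := by
  refine Subalgebra.mem_map.2 ⟨quot (fun i => X i + C (n : ℂ))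
    (fun j => fallPoly _ (m j + (n - (j + 1)))), ?_, ?_⟩
  · rw [mem_symmetricSubalgebra]
    intro σ
    have h := map_quot (rename σ : MvPolynomial (Fin n) ℂ →ₐ[ℂ] _).toRingHom
      (fun i => X i + C (n : ℂ)) (fun j : Fin n => fallPoly _ (m j + (n - (j + 1))))
    refine h.trans ?_
    simp only [fallPoly_map, AlgHom.toRingHom_eq_coe, RingHom.coe_coe, map_add, rename_X, rename_C]
    have hn : (nodal fun i : Fin n => (X (σ i) + C (n : ℂ) : MvPolynomial (Fin n) ℂ)) =
        nodal fun i : Fin n => (X i + C (n : ℂ) : MvPolynomial (Fin n) ℂ) :=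
      Equiv.prod_comp σ fun i : Fin n => (Polynomial.X - Polynomial.C
        (X i + C (n : ℂ) : MvPolynomial (Fin n) ℂ))
    simp only [quot, hn]
  · rw [ratio_eq_quot]
    refine (map_quot (shift n).toRingHom _ _).trans ?_
    simp only [fallPoly_map]
    congr 1
    funext i
    have h1 : shift n (X i) = X i - C ((i : ℂ) + 1) := by simp [shift]
    have h2 : shift n (C (n : ℂ)) = C (n : ℂ) := (shift n).commutes _
    change shift n (X i + C (n : ℂ)) = _
    rw [map_add, h1, h2, yvar, map_sub]
    ring

theorem ratio_degree_le (n : ℕ) (m : ℕ → ℕ) : (ratio n m).totalDegree ≤ ∑ j : Fin n, m j := by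
  by_cases h : ratio n m = 0
  · simp [h]
  have h1 := alternant_degree_le n m
  rw [← ratio_mul, totalDegree_mul_of_isDomain h (alternant_zero_degree n).1,
    Finset.sum_add_distrib] at h1
  have h2 := (alternant_zero_degree n).2
  omega

theorem proj_C (n : ℕ) (c : ℂ) : proj n (C c) = C c := (proj n).commutes c

theorem proj_last (n : ℕ) : proj n (X (Fin.last n)) = 0 := by simp [proj]

theorem proj_castSucc (n : ℕ) (i : Fin n) : proj n (X i.castSucc) = X i := by simp [proj]

theorem fall_succ' {R : Type*} [CommRing R] (y : R) (m : ℕ) :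
    fall y (m + 1) = y * fall (y - 1) m := by
  rw [fall, Finset.prod_range_succ', fall, mul_comm]
  congr 1
  · simp
  · exact Finset.prod_congr rfl fun k _ => by push_cast; ring

theorem proj_entry (n : ℕ) (i : Fin (n + 1)) (k : ℕ) :
    proj n (fall (X i + C (((n + 1 : ℕ) : ℂ) - ((i : ℂ) + 1))) k) =
      fall (proj n (X i) + C (((n + 1 : ℕ) : ℂ) - ((i : ℂ) + 1))) k := by
  have := map_fall (proj n).toRingHom (X i + C (((n + 1 : ℕ) : ℂ) - ((i : ℂ) + 1))) k
  refine this.trans ?_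
  congr 1
  change proj n _ = _
  rw [map_add, proj_C]

theorem proj_alternant (n : ℕ) (m : ℕ → ℕ) (hm : m n = 0) :
    proj n (alternant (n + 1) m) =
      (∏ i : Fin n, (X i + C (((n + 1 : ℕ) : ℂ) - ((i : ℂ) + 1)))) * alternant n m := by
  rw [alternant]
  refine (AlgHom.map_det (proj n) _).trans ?_
  rw [Matrix.det_succ_row _ (Fin.last n), Fin.sum_univ_castSucc, Finset.sum_eq_zero, zero_add]
  · have h1 : ((proj n).mapMatrix (Matrix.of fun i j : Fin (n + 1) =>
        fall (X i + C (((n + 1 : ℕ) : ℂ) - ((i : ℂ) + 1))) (m j + (n + 1 - (j + 1)))))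
        (Fin.last n) (Fin.last n) = 1 := by
      rw [AlgHom.mapMatrix_apply, Matrix.map_apply, Matrix.of_apply, proj_entry]
      simp [hm, fall]
    rw [h1, ← two_mul, pow_mul]
    simp only [even_two, Even.neg_pow, one_pow, one_mul, Fin.succAbove_last]
    rw [alternant, ← Matrix.det_mul_column]
    congr 1
    ext1 i j
    simp only [Matrix.submatrix_apply, AlgHom.mapMatrix_apply, Matrix.map_apply, Matrix.of_apply]
    rw [proj_entry, proj_castSucc]
    have h2 : m (j.castSucc : Fin (n+1)) + (n + 1 - ((j.castSucc : Fin (n + 1)) + 1)) =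
        m j + (n - (j + 1)) + 1 := by
      have := j.2
      simp only [Fin.val_castSucc]
      omega
    rw [h2, fall_succ', Fin.val_castSucc]
    congr 2
    rw [add_sub_assoc, ← C_1, ← C_sub]
    congr 2
    push_cast
    ring
  · intro j _
    rw [AlgHom.mapMatrix_apply, Matrix.map_apply, Matrix.of_apply, proj_entry, proj_last]
    have h2 : m (j.castSucc : Fin (n+1)) + (n + 1 - ((j.castSucc : Fin (n + 1)) + 1)) =
        m j + (n - (j + 1)) + 1 := by
      have := j.2
      simp only [Fin.val_castSucc]
      omega
    rw [h2, fall_succ']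
    simp

theorem proj_alternant_of_pos (n : ℕ) (m : ℕ → ℕ) (hm : 0 < m n) (hanti : Antitone m) :
    proj n (alternant (n + 1) m) = 0 := by
  rw [alternant]
  refine (AlgHom.map_det (proj n) _).trans ?_
  apply Matrix.det_eq_zero_of_row_eq_zero (Fin.last n)
  intro j
  rw [AlgHom.mapMatrix_apply, Matrix.map_apply, Matrix.of_apply, proj_entry, proj_last]
  have : m n ≤ m j := hanti (by omega)
  obtain ⟨k, hk⟩ : ∃ k, m j + (n + 1 - (j + 1)) = k + 1 := ⟨_, (Nat.succ_pred (by omega)).symm⟩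
  rw [hk, fall_succ']
  simp

theorem proj_ratio (n : ℕ) (m : ℕ → ℕ) (hm : m n = 0) :
    proj n (ratio (n + 1) m) = ratio n m := by
  have h := congrArg (proj n) (ratio_mul (n + 1) m)
  have h0 := proj_alternant n (fun _ => 0) rfl
  rw [map_mul, proj_alternant n m hm, h0, ← ratio_mul n m] at h
  have hne : proj n (alternant (n + 1) fun _ => 0) ≠ 0 := by
    rw [h0]
    refine mul_ne_zero (Finset.prod_ne_zero_iff.2 fun i _ hi => ?_) (alternant_zero_degree n).1
    have := congrArg (coeff (Finsupp.single i 1)) hi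
    have h0 : (0 : Fin n →₀ ℕ) ≠ Finsupp.single i 1 := by
      intro h
      have := DFunLike.congr_fun h i
      simp at this
    rw [coeff_add, coeff_C, if_neg h0] at this
    simp at this
  rw [h0] at hne
  apply mul_right_cancel₀ hne
  rw [h]
  ring

theorem proj_ratio_of_pos (n : ℕ) (m : ℕ → ℕ) (hm : 0 < m n) (hanti : Antitone m) :
    proj n (ratio (n + 1) m) = 0 := by
  have h := congrArg (proj n) (ratio_mul (n + 1) m)
  have h0 := proj_alternant n (fun _ => 0) rfl
  rw [map_mul, proj_alternant_of_pos n m hm hanti, h0] at h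
  refine (mul_eq_zero.1 h).resolve_right ?_
  refine mul_ne_zero (Finset.prod_ne_zero_iff.2 fun i _ hi => ?_) (alternant_zero_degree n).1
  have := congrArg (coeff (Finsupp.single i 1)) hi
  have h0 : (0 : Fin n →₀ ℕ) ≠ Finsupp.single i 1 := by
    intro h
    have := DFunLike.congr_fun h i
    simp at this
  rw [coeff_add, coeff_C, if_neg h0] at this
  simp at this

/-- The shifted Schur function `s*_μ ∈ Λ*`. For `n ≥ ℓ(μ)` its image in `Λ*ₙ` is the ratio of
determinants; for `n < ℓ(μ)` that image, obtained by setting variables equal to `0`, vanishes. -/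
noncomputable def shiftedSchur (μ : YoungDiagram) : ShiftedSym :=
  ⟨fun n => if μ.colLen 0 ≤ n then ratio n μ.rowLen else 0, by
    have hlen : ∀ n, 0 < μ.rowLen n ↔ n < μ.colLen 0 := fun n => by
      rw [← YoungDiagram.mem_iff_lt_rowLen, YoungDiagram.mem_iff_lt_colLen]
    refine ⟨fun n => ?_, fun n => ?_, ∑ j ∈ Finset.range (μ.colLen 0), μ.rowLen j, fun n => ?_⟩
    · dsimp only
      split_ifs
      · exact ratio_mem n _
      · exact zero_mem _
    · dsimp only
      have hn := hlen n
      split_ifs with h1 h2 h2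
      · exact proj_ratio n _ (by omega)
      · exact proj_ratio_of_pos n _ (by omega) fun i j hij => μ.rowLen_anti i j hij
      · omega
      · exact map_zero _
    · dsimp only
      split_ifs with h
      · refine (ratio_degree_le n _).trans ?_
        rw [Finset.sum_range, ← Finset.sum_range (f := μ.rowLen), ← Finset.sum_range (f := μ.rowLen)]
        rw [← Finset.sum_subset (Finset.range_mono h)]
        intro i _ hi
        have := hlen i
        simp only [Finset.mem_range] at hi
        omega
      · simp⟩

theorem shiftedSchur_mul (μ : YoungDiagram) (n : ℕ) (hn : μ.colLen 0 ≤ n) :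
    (shiftedSchur μ).1 n * alternant n (fun _ => 0) = alternant n μ.rowLen := by
  simp only [shiftedSchur, if_pos hn]
  exact ratio_mul n _

/-! ### The structure of `Λ*` -/

/-- The subalgebra generated by the first `d` power sums. -/
noncomputable def psumAlg (n d : ℕ) : Subalgebra ℂ (MvPolynomial (Fin n) ℂ) :=
  Algebra.adjoin ℂ (Set.range fun j : Fin d => psum (Fin n) ℂ (j + 1))

theorem psum_mem {n d k : ℕ} (h0 : 0 < k) (h : k ≤ d) : psum (Fin n) ℂ k ∈ psumAlg n d :=
  Algebra.subset_adjoin ⟨⟨k - 1, by omega⟩, by simp [Nat.sub_add_cancel h0]⟩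

theorem esymm_mem {n d : ℕ} (k : ℕ) (h : k ≤ d) : esymm (Fin n) ℂ k ∈ psumAlg n d := by
  induction k using Nat.strong_induction_on with
  | _ k ih =>
    rcases Nat.eq_zero_or_pos k with rfl | hk
    · simp [one_mem]
    · have h1 := mul_esymm_eq_sum (Fin n) ℂ k
      have h2 : esymm (Fin n) ℂ k = C (1 / (k : ℂ)) * ((k : MvPolynomial (Fin n) ℂ) * esymm (Fin n) ℂ k) := by
        have hk' : (k : ℂ) ≠ 0 := by exact_mod_cast hk.ne'
        have : (k : MvPolynomial (Fin n) ℂ) = C (k : ℂ) := by simp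
        rw [← mul_assoc, this, ← C_mul, one_div_mul_cancel hk', C_1, one_mul]
      rw [h2, h1]
      have hneg : ∀ j : ℕ, ((-1 : MvPolynomial (Fin n) ℂ) ^ j) ∈ psumAlg n d := fun j =>
        pow_mem (neg_mem (one_mem _)) j
      refine mul_mem (Subalgebra.algebraMap_mem _ _) (mul_mem (hneg _) (sum_mem fun a ha => ?_))
      rw [Finset.mem_filter, Finset.HasAntidiagonal.mem_antidiagonal] at ha
      exact mul_mem (mul_mem (hneg _) (ih _ ha.2 (by omega))) (psum_mem (by omega) (by omega))

theorem esymm_isHomogeneous (n k : ℕ) : (esymm (Fin n) ℂ k).IsHomogeneous k := by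
  rw [esymm]
  refine IsHomogeneous.sum _ _ _ fun t ht => ?_
  rw [Finset.mem_powersetCard] at ht
  have := IsHomogeneous.prod t (fun i => (X i : MvPolynomial (Fin n) ℂ)) (fun _ => 1)
    fun i _ => isHomogeneous_X ℂ i
  simpa [ht.2] using this

theorem symm_mem_psumAlg {n d : ℕ} (g : MvPolynomial (Fin n) ℂ) (hg : g.IsSymmetric)
    (hd : g.totalDegree ≤ d) : g ∈ psumAlg n d := by
  obtain ⟨Q, hQ⟩ := (esymmAlgHom_fin_bijective ℂ n).2 ⟨g, hg⟩
  have hQ' : g = aeval (fun i : Fin n => esymm (Fin n) ℂ (i + 1)) Q := by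
    rw [← esymmAlgHom_apply, hQ]
  rw [← sum_homogeneousComponent g]
  refine sum_mem fun m hm => ?_
  rw [Finset.mem_range] at hm
  rw [hQ', aeval_def, eval₂_eq', map_sum]
  refine sum_mem fun s _ => ?_
  rw [algebraMap_eq, homogeneousComponent_C_mul]
  refine mul_mem (Subalgebra.algebraMap_mem _ _) ?_
  have hom : (∏ i : Fin n, esymm (Fin n) ℂ (i + 1) ^ s i).IsHomogeneous
      (∑ i : Fin n, (i + 1) * s i) :=
    IsHomogeneous.prod _ _ _ fun i _ => (esymm_isHomogeneous n _).pow _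
  rw [homogeneousComponent_of_mem hom]
  split_ifs with hms
  · refine prod_mem fun i _ => ?_
    by_cases hsi : s i = 0
    · simp [hsi, one_mem]
    · refine pow_mem (esymm_mem _ ?_) _
      have : ((i : ℕ) + 1) * s i ≤ ∑ i : Fin n, ((i : ℕ) + 1) * s i :=
        Finset.single_le_sum (f := fun i : Fin n => ((i : ℕ) + 1) * s i) (fun _ _ => Nat.zero_le _)
          (Finset.mem_univ i)
      have h1 : (i : ℕ) + 1 ≤ ((i : ℕ) + 1) * s i := Nat.le_mul_of_pos_right _ (by omega)
      omega
  · exact zero_mem _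

theorem surj_endo_inj {R : Type*} [CommRing R] [IsNoetherianRing R] (f : R →+* R)
    (hf : Function.Surjective f) : Function.Injective f := by
  rw [injective_iff_map_eq_zero]
  intro x hx
  let F : ℕ →o Submodule R R := ⟨fun k : ℕ => (RingHom.ker (f ^ k : R →+* R) : Ideal R), by
    apply monotone_nat_of_le_succ
    intro k y hy
    have hy : (f ^ k) y = 0 := hy
    change (f ^ (k + 1)) y = 0
    rw [pow_succ', RingHom.mul_def, RingHom.comp_apply, hy, map_zero]⟩
  obtain ⟨k, hk⟩ := monotone_stabilizes_iff_noetherian.2 ‹IsNoetherianRing R› F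
  have hs : ∀ k : ℕ, Function.Surjective (f ^ k : R →+* R) := by
    intro k
    induction k with
    | zero => exact fun y => ⟨y, rfl⟩
    | succ k ih =>
      rw [pow_succ, RingHom.mul_def, RingHom.coe_comp]
      exact ih.comp hf
  obtain ⟨y, rfl⟩ := hs k x
  have h1 : y ∈ F (k + 1) := by
    change (f ^ (k + 1)) y = 0
    rw [pow_succ', RingHom.mul_def, RingHom.comp_apply, hx]
  rw [← hk (k + 1) (Nat.le_succ k)] at h1
  exact h1

theorem psum_aeval_injective (d : ℕ) :
    Function.Injective (aeval (R := ℂ) fun j : Fin d => psum (Fin d) ℂ (j + 1)) := by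
  let ψ : MvPolynomial (Fin d) ℂ →ₐ[ℂ] symmetricSubalgebra (Fin d) ℂ :=
    aeval fun j => ⟨psum (Fin d) ℂ (j + 1), psum_isSymmetric _ _ _⟩
  have hψ : ∀ P, (ψ P).1 = aeval (fun j : Fin d => psum (Fin d) ℂ (j + 1)) P := fun P =>
    (Subalgebra.mvPolynomial_aeval_coe _ _ _).symm
  have hsurj : Function.Surjective ψ := by
    rintro ⟨g, hg⟩
    obtain ⟨Q, hQ⟩ := (esymmAlgHom_fin_bijective ℂ d).2 ⟨g, hg⟩
    have hQ' : g = aeval (fun i : Fin d => esymm (Fin d) ℂ (i + 1)) Q := by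
      rw [← esymmAlgHom_apply, hQ]
    have : g ∈ psumAlg d d := by
      rw [hQ', aeval_def, eval₂_eq']
      exact sum_mem fun s _ => mul_mem (Subalgebra.algebraMap_mem _ _)
        (prod_mem fun i _ => pow_mem (esymm_mem _ i.2) _)
    rw [psumAlg, Algebra.adjoin_range_eq_range_aeval] at this
    obtain ⟨P, hP⟩ := this
    exact ⟨P, Subtype.ext ((hψ P).trans hP)⟩
  have e := esymmAlgEquiv (Fin d) ℂ (Fintype.card_fin d)
  have hi : Function.Injective ψ := by
    have := surj_endo_inj (e.symm.toAlgHom.comp ψ).toRingHom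
      (e.symm.surjective.comp hsurj)
    exact Function.Injective.of_comp (f := e.symm) this
  intro P Q h
  apply hi
  apply Subtype.ext
  rw [hψ, hψ]
  exact h

/-- The change of variables `x_i ↦ x_i - i + 1/2` (1-based `i`). -/
noncomputable def cshift (n : ℕ) : MvPolynomial (Fin n) ℂ →ₐ[ℂ] MvPolynomial (Fin n) ℂ :=
  aeval fun i => X i - C ((i : ℂ) + 1 / 2)

/-- The inverse change of variables. -/
noncomputable def cshiftInv (n : ℕ) : MvPolynomial (Fin n) ℂ →ₐ[ℂ] MvPolynomial (Fin n) ℂ :=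
  aeval fun i => X i + C ((i : ℂ) + 1 / 2)

theorem cshift_cshiftInv (n : ℕ) (f : MvPolynomial (Fin n) ℂ) :
    cshift n (cshiftInv n f) = f := by
  have : (cshift n).comp (cshiftInv n) = AlgHom.id ℂ _ := by
    ext1 i
    have : (cshift n) (C ((i : ℂ) + 1 / 2)) = C ((i : ℂ) + 1 / 2) := (cshift n).commutes _
    rw [AlgHom.comp_apply, cshiftInv, aeval_X, map_add, this, cshift, aeval_X]
    simp
  exact DFunLike.congr_fun this f

theorem cshiftInv_cshift (n : ℕ) (f : MvPolynomial (Fin n) ℂ) :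
    cshiftInv n (cshift n f) = f := by
  have : (cshiftInv n).comp (cshift n) = AlgHom.id ℂ _ := by
    ext1 i
    have : (cshiftInv n) (C ((i : ℂ) + 1 / 2)) = C ((i : ℂ) + 1 / 2) := (cshiftInv n).commutes _
    rw [AlgHom.comp_apply, cshift, aeval_X, map_sub, this, cshiftInv, aeval_X]
    simp
  exact DFunLike.congr_fun this f

theorem cshiftInv_degree (n : ℕ) (f : MvPolynomial (Fin n) ℂ) :
    (cshiftInv n f).totalDegree ≤ f.totalDegree := by
  rw [cshiftInv, aeval_def, eval₂_eq']
  refine totalDegree_finsetSum_le fun s hs => ?_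
  refine (totalDegree_mul _ _).trans ?_
  rw [algebraMap_eq, totalDegree_C, zero_add]
  refine (totalDegree_finsetProd _ _).trans ?_
  refine le_trans ?_ (le_totalDegree hs)
  rw [Finsupp.sum_fintype _ _ (by simp)]
  refine Finset.sum_le_sum fun i _ => ?_
  refine (totalDegree_pow _ _).trans ?_
  have : (X i + C ((i : ℂ) + 1 / 2) : MvPolynomial (Fin n) ℂ).totalDegree ≤ 1 := by
    refine (totalDegree_add _ _).trans ?_
    rw [totalDegree_X, totalDegree_C]
    simp
  calc _ ≤ s i * 1 := Nat.mul_le_mul_left _ this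
    _ = s i := mul_one _

theorem symmetric_translate {n : ℕ} (c : ℂ) (g : MvPolynomial (Fin n) ℂ) (hg : g.IsSymmetric) :
    (aeval (fun i => X i + C c) g : MvPolynomial (Fin n) ℂ).IsSymmetric := by
  intro σ
  have h : (rename σ).comp (aeval fun i => X i + C c) =
      (aeval (R := ℂ) fun i => (X i + C c : MvPolynomial (Fin n) ℂ)).comp (rename σ) := by
    ext1 i
    simp
  calc rename σ (aeval (fun i => X i + C c) g)
      = ((rename σ).comp (aeval fun i => X i + C c)) g := rfl
    _ = _ := by rw [h, AlgHom.comp_apply, hg σ]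

theorem mem_level_iff (n : ℕ) (f : MvPolynomial (Fin n) ℂ) :
    f ∈ shiftedSymLevel n ↔ (cshiftInv n f).IsSymmetric := by
  have key : ∀ c : ℂ, ∀ g : MvPolynomial (Fin n) ℂ, c = 1 / 2 →
      shift n (aeval (fun i => X i + C c) g) = cshift n g := by
    intro c g hc
    have : (shift n).comp (aeval fun i => X i + C c) = cshift n := by
      ext1 i
      have h1 : (shift n) (C c) = C c := (shift n).commutes _
      rw [AlgHom.comp_apply, aeval_X, map_add, h1, shift, aeval_X, cshift, aeval_X, sub_add,
        ← C_sub, hc]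
      congr 2
      ring
    exact DFunLike.congr_fun this g
  have key2 : ∀ g : MvPolynomial (Fin n) ℂ,
      cshiftInv n (shift n g) = aeval (fun i => X i + C (-(1 / 2) : ℂ)) g := by
    intro g
    have : (cshiftInv n).comp (shift n) = aeval (fun i => X i + C (-(1 / 2) : ℂ)) := by
      ext1 i
      have h1 : (cshiftInv n) (C ((i : ℂ) + 1)) = C ((i : ℂ) + 1) := (cshiftInv n).commutes _
      rw [AlgHom.comp_apply, shift, aeval_X, map_sub, h1, cshiftInv, aeval_X, aeval_X, add_sub_assoc,
        ← C_sub]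
      congr 2
      ring
    exact DFunLike.congr_fun this g
  constructor
  · rintro ⟨g, hg, rfl⟩
    change (cshiftInv n (shift n g)).IsSymmetric
    rw [key2]
    exact symmetric_translate _ _ hg
  · intro h
    refine ⟨_, symmetric_translate (1 / 2) _ h, ?_⟩
    change shift n _ = f
    rw [key _ _ rfl, cshift_cshiftInv]

/-- The shifted power sum `∑_i ((x_i - i + 1/2)^k - (-i + 1/2)^k)` (1-based `i`). -/
noncomputable def powLevel (n k : ℕ) : MvPolynomial (Fin n) ℂ :=
  ∑ i : Fin n, ((X i - C ((i : ℂ) + 1 / 2)) ^ k - C ((-((i : ℂ) + 1 / 2)) ^ k))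

theorem powLevel_eq (n k : ℕ) : powLevel n k =
    cshift n (psum (Fin n) ℂ k) - C (∑ i : Fin n, (-((i : ℂ) + 1 / 2)) ^ k) := by
  simp only [powLevel, Finset.sum_sub_distrib, psum, map_sum, map_pow]
  simp [cshift]

theorem proj_powLevel (n k : ℕ) : proj n (powLevel (n + 1) k) = powLevel n k := by
  rw [powLevel, map_sum, Fin.sum_univ_castSucc]
  simp only [map_sub, map_pow, proj_C, proj_castSucc, proj_last]
  simp only [Fin.val_castSucc, Fin.val_last, powLevel]
  simp

/-- The shifted power sums as elements of `Λ*`. -/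
noncomputable def powStar (k : ℕ+) : ShiftedSym :=
  ⟨fun n => powLevel n k, fun n => by
    rw [mem_level_iff]
    change (cshiftInv n (powLevel n k)).IsSymmetric
    rw [powLevel_eq, map_sub, cshiftInv_cshift]
    have h1 : ∀ c : ℂ, (cshiftInv n) (C c) = C c := (cshiftInv n).commutes
    rw [h1]
    exact (psum_isSymmetric _ _ _).sub (IsSymmetric.C _),
   fun n => proj_powLevel n k, k, fun n => by
    change (powLevel n k).totalDegree ≤ k
    rw [powLevel]
    refine totalDegree_finsetSum_le fun i _ => ?_
    refine (totalDegree_sub _ _).trans ?_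
    rw [totalDegree_C]
    refine max_le ((totalDegree_pow _ _).trans ?_) (Nat.zero_le _)
    have : (X i - C ((i : ℂ) + 1 / 2) : MvPolynomial (Fin n) ℂ).totalDegree ≤ 1 := by
      refine (totalDegree_sub _ _).trans ?_
      rw [totalDegree_X, totalDegree_C]
      simp
    calc _ ≤ (k : ℕ) * 1 := Nat.mul_le_mul_left _ this
      _ = k := mul_one _⟩

/-- The projection of `Λ*` to `ℂ[x₁,…,xₙ]`. -/
noncomputable def level (n : ℕ) : ShiftedSym →ₐ[ℂ] MvPolynomial (Fin n) ℂ :=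
  (Pi.evalAlgHom ℂ (fun n : ℕ => MvPolynomial (Fin n) ℂ) n).comp ShiftedSym.val

theorem level_ext {f g : ShiftedSym} (h : ∀ n, level n f = level n g) : f = g :=
  Subtype.ext (funext h)

theorem proj_level (n : ℕ) (f : ShiftedSym) : proj n (level (n + 1) f) = level n f := f.2.2.1 n

theorem level_eq_of_le {f g : ShiftedSym} {n m : ℕ} (hnm : n ≤ m) (h : level m f = level m g) :
    level n f = level n g := by
  induction m, hnm using Nat.le_induction with
  | base => exact h
  | succ m _ ih => exact ih (by rw [← proj_level, h, proj_level])

theorem powLevel_aeval_injective (d : ℕ) :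
    Function.Injective (aeval (R := ℂ) fun j : Fin d => powLevel d (j + 1)) := by
  set c : Fin d → ℂ := fun j => ∑ i : Fin d, (-((i : ℂ) + 1 / 2)) ^ ((j : ℕ) + 1)
  let τ : MvPolynomial (Fin d) ℂ →ₐ[ℂ] MvPolynomial (Fin d) ℂ := aeval fun j => X j - C (c j)
  let τ' : MvPolynomial (Fin d) ℂ →ₐ[ℂ] MvPolynomial (Fin d) ℂ := aeval fun j => X j + C (c j)
  have hτ : Function.Injective τ := by
    have : τ'.comp τ = AlgHom.id ℂ _ := by
      ext1 i
      have : τ' (C (c i)) = C (c i) := τ'.commutes _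
      rw [AlgHom.comp_apply]
      simp only [τ, aeval_X, map_sub, this]
      simp [τ']
    exact Function.LeftInverse.injective (g := τ') fun x => DFunLike.congr_fun this x
  have hcs : Function.Injective (cshift d) := Function.LeftInverse.injective (cshiftInv_cshift d)
  have : (aeval (R := ℂ) fun j : Fin d => powLevel d (j + 1)) =
      ((cshift d).comp (aeval (R := ℂ) fun j : Fin d => psum (Fin d) ℂ (j + 1))).comp τ := by
    ext1 j
    rw [AlgHom.comp_apply, aeval_X, powLevel_eq]
    have h1 : ∀ a : ℂ, ((cshift d).comp (aeval (R := ℂ) fun j : Fin d => psum (Fin d) ℂ (j + 1)))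
      (C a) = C a := AlgHom.commutes _
    simp only [τ, aeval_X, map_sub, h1]
    rw [AlgHom.comp_apply, aeval_X]
  rw [this]
  exact (hcs.comp (psum_aeval_injective d)).comp hτ

/-- `Λ = ℂ[p₁, p₂, …]`, the algebra of symmetric functions; `X k` is the power sum `p_k`. -/
abbrev Lam : Type := MvPolynomial ℕ+ ℂ

/-- The homomorphism `Λ → Λ*` taking power sums to shifted power sums. -/
noncomputable def psi : Lam →ₐ[ℂ] ShiftedSym := aeval powStar

/-- The inclusion of `ℂ[p₁,…,p_d]`. -/
def emb (d : ℕ) (j : Fin d) : ℕ+ := ⟨j + 1, Nat.succ_pos _⟩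

theorem level_psi_rename (n d : ℕ) (P : MvPolynomial (Fin d) ℂ) :
    level n (psi (rename (emb d) P)) = aeval (fun j : Fin d => powLevel n (j + 1)) P := by
  have : ((level n).comp psi).comp (rename (emb d)) =
      aeval (fun j : Fin d => powLevel n (j + 1)) := by
    ext1 j
    simp only [AlgHom.comp_apply, rename_X, psi, aeval_X]
    rfl
  exact DFunLike.congr_fun this P

theorem emb_injective (d : ℕ) : Function.Injective (emb d) := by
  intro i j h
  have := congrArg PNat.val h
  simp only [emb, PNat.mk_coe] at this
  exact Fin.ext (by omega)

theorem psi_injective : Function.Injective psi := by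
  rw [injective_iff_map_eq_zero]
  intro P hP
  set d := P.vars.sup fun k => (k : ℕ) with hd
  obtain ⟨Q, hQ⟩ := exists_rename_eq_of_vars_subset_range P (emb d) (emb_injective d) (by
    intro k hk
    have h1 : (k : ℕ) ≤ d := Finset.le_sup (f := fun k : ℕ+ => (k : ℕ)) hk
    have h2 := k.pos
    exact ⟨⟨k - 1, by omega⟩, PNat.eq (by simp only [emb, PNat.mk_coe]; omega)⟩)
  have h1 := level_psi_rename d d Q
  rw [hQ, hP, map_zero] at h1
  have : Q = 0 := powLevel_aeval_injective d (by rw [← h1, map_zero])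
  rw [← hQ, this, map_zero]

theorem psi_surjective : Function.Surjective psi := by
  intro f
  obtain ⟨d, hd⟩ := f.2.2.2
  have h : ∀ n, ∃ P : MvPolynomial (Fin d) ℂ,
      aeval (fun j : Fin d => powLevel n (j + 1)) P = level n f := by
    intro n
    have h1 := symm_mem_psumAlg _ ((mem_level_iff n _).1 (f.2.1 n))
      ((cshiftInv_degree n _).trans (hd n))
    have h2 : level n f ∈ (psumAlg n d).map (cshift n) :=
      ⟨_, h1, cshift_cshiftInv n (f.1 n)⟩
    have h3 : (psumAlg n d).map (cshift n) ≤
        (aeval (R := ℂ) fun j : Fin d => powLevel n (j + 1)).range := by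
      rw [psumAlg, AlgHom.map_adjoin, Algebra.adjoin_le_iff]
      rintro _ ⟨_, ⟨j, rfl⟩, rfl⟩
      have := powLevel_eq n (j + 1)
      rw [eq_sub_iff_add_eq] at this
      change cshift n _ ∈ _
      rw [← this]
      exact add_mem ⟨X j, by simp⟩ (Subalgebra.algebraMap_mem _ _)
    exact h3 h2
  choose P hP using h
  refine ⟨rename (emb d) (P d), level_ext fun n => ?_⟩
  have hbig : ∀ n, d ≤ n → level n (psi (rename (emb d) (P d))) = level n f := by
    intro n hn
    have h1 : level n (psi (rename (emb d) (P n))) = level n f := by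
      rw [level_psi_rename, hP]
    have h2 := level_eq_of_le hn h1
    rw [level_psi_rename, ← hP d] at h2
    rw [← powLevel_aeval_injective d h2, h1]
  rcases le_total d n with hn | hn
  · exact hbig n hn
  · exact level_eq_of_le hn (hbig d le_rfl)

/-! ### Formal series in `1/u` -/

/-- The sum `∑_k f_k` of power series such that `f_k` is divisible by the `k`-th power of the
variable: the coefficient of degree `n` only involves `f_0, …, f_n`. -/
noncomputable def formalSum {R : Type*} [CommRing R] (f : ℕ → PowerSeries R) : PowerSeries R :=
  PowerSeries.mk fun n => ∑ k ∈ Finset.range (n + 1), PowerSeries.coeff n (f k)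

/-- `1 / (u - a)` as a power series in `1/u`, that is, `∑_{n ≥ 0} a^n / u^(n+1)`. -/
noncomputable def invLin {R : Type*} [CommRing R] [Algebra ℂ R] (a : ℂ) : PowerSeries R :=
  PowerSeries.X * PowerSeries.mk fun n => algebraMap ℂ R (a ^ n)

/-- `1 / (u (u - 1) ⋯ (u - k + 1))` as a power series in `1/u`. -/
noncomputable def invFall {R : Type*} [CommRing R] [Algebra ℂ R] (k : ℕ) : PowerSeries R :=
  ∏ j ∈ Finset.range k, invLin (j : ℂ)

theorem invLin_mul {R : Type*} [CommRing R] [Algebra ℂ R] (a : ℂ) :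
    invLin a * (1 - PowerSeries.C (algebraMap ℂ R a) * PowerSeries.X) = PowerSeries.X := by
  have : (PowerSeries.mk fun n => algebraMap ℂ R (a ^ n)) *
      (1 - PowerSeries.C (algebraMap ℂ R a) * PowerSeries.X) = 1 := by
    ext n
    cases n with
    | zero => simp [mul_sub]
    | succ n =>
      rw [mul_sub, mul_one, map_sub, ← mul_assoc, PowerSeries.coeff_succ_mul_X,
        PowerSeries.coeff_mul_C]
      simp [pow_succ, PowerSeries.coeff_one]
  rw [invLin, mul_assoc, this, mul_one]

theorem X_pow_dvd_invFall {R : Type*} [CommRing R] [Algebra ℂ R] (k : ℕ) :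
    (PowerSeries.X : PowerSeries R) ^ k ∣ invFall k := by
  have := Finset.prod_dvd_prod_of_dvd (s := Finset.range k)
    (fun _ => (PowerSeries.X : PowerSeries R)) (fun j => invLin (j : ℂ))
    (fun j _ => Dvd.intro _ rfl)
  rw [invFall]
  simpa using this

theorem dvd_formalSum_sub {R : Type*} [CommRing R] (f : ℕ → PowerSeries R)
    (hf : ∀ k, PowerSeries.X ^ k ∣ f k) (m : ℕ) :
    PowerSeries.X ^ m ∣ formalSum f - ∑ k ∈ Finset.range m, f k := by
  rw [PowerSeries.X_pow_dvd_iff]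
  intro j hj
  rw [map_sub, formalSum, PowerSeries.coeff_mk, map_sum, sub_eq_zero]
  apply Finset.sum_subset (Finset.range_mono hj)
  intro k _ hk
  have := PowerSeries.X_pow_dvd_iff.1 (hf k) j
  simp only [Finset.mem_range] at hk
  exact this (by omega)

theorem eq_of_dvd_all {R : Type*} [CommRing R] {f g : PowerSeries R}
    (h : ∀ m, PowerSeries.X ^ m ∣ f - g) : f = g := by
  ext n
  have := PowerSeries.X_pow_dvd_iff.1 (h (n + 1)) n (Nat.lt_succ_self n)
  rwa [map_sub, sub_eq_zero] at this

/-! ### The generating series `H*(u)` -/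

/-- The one-row Young diagram `(k)`. -/
def rowDiagram (k : ℕ) : YoungDiagram where
  cells := {0} ×ˢ Finset.range k
  isLowerSet := by
    rintro ⟨a, b⟩ ⟨c, d⟩ ⟨h1, h2⟩ h
    simp only [Finset.coe_product, Finset.coe_singleton, Finset.coe_range, Set.mem_prod,
      Set.mem_singleton_iff, Set.mem_Iio] at h ⊢
    simp only at h1 h2
    omega

theorem rowDiagram_rowLen (k : ℕ) : (rowDiagram k).rowLen = fun i => if i = 0 then k else 0 := by
  funext i
  apply eq_of_forall_lt_iff
  intro j
  rw [← YoungDiagram.mem_iff_lt_rowLen, ← YoungDiagram.mem_cells]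
  simp only [rowDiagram, Finset.mem_product, Finset.mem_singleton, Finset.mem_range]
  split_ifs with h <;> simp [h]

theorem rowDiagram_colLen (k : ℕ) : (rowDiagram k).colLen 0 ≤ 1 := by
  by_contra h
  have : 1 < (rowDiagram k).colLen 0 := by omega
  rw [← YoungDiagram.mem_iff_lt_colLen, ← YoungDiagram.mem_cells] at this
  simp [rowDiagram] at this

/-- `h*_k = s*_{(k)}`. -/
noncomputable def hStar (k : ℕ) : ShiftedSym := shiftedSchur (rowDiagram k)

/-- `H*(u) = 1 + ∑_{k ≥ 1} h*_k / (u (u - 1) ⋯ (u - k + 1))` as a power series in `1/u` (the term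
`k = 0` is `h*_0 = s*_∅ = 1`). -/
noncomputable def HStar : PowerSeries ShiftedSym :=
  formalSum fun k => PowerSeries.C (hStar k) * invFall k

section HStarProduct

variable (N : ℕ)

theorem telescoping (y : MvPolynomial (Fin (N + 1)) ℂ) :
    (formalSum fun k => PowerSeries.C (fall y (k + N)) * invFall k) *
      (1 + PowerSeries.C (((N + 1 : ℕ) : MvPolynomial (Fin (N + 1)) ℂ) - y) * PowerSeries.X) =
      PowerSeries.C (fall y N) * (1 + PowerSeries.X) := by
  have hdvd : ∀ k, PowerSeries.X ^ k ∣ (PowerSeries.C (fall y (k + N)) * invFall k :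
      PowerSeries (MvPolynomial (Fin (N + 1)) ℂ)) :=
    fun k => Dvd.dvd.mul_left (X_pow_dvd_invFall k) _
  have hpart : ∀ m, (∑ k ∈ Finset.range (m + 1), PowerSeries.C (fall y (k + N)) * invFall k) *
      (1 + PowerSeries.C (((N + 1 : ℕ) : MvPolynomial (Fin (N + 1)) ℂ) - y) * PowerSeries.X) =
      PowerSeries.C (fall y N) * (1 + PowerSeries.X) -
        PowerSeries.X * (PowerSeries.C (fall y (m + N + 1)) * invFall m) := by
    have hf : ∀ a, (PowerSeries.C (fall y (a + 1)) :
        PowerSeries (MvPolynomial (Fin (N + 1)) ℂ)) =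
        PowerSeries.C (fall y a) * (PowerSeries.C y - (a : PowerSeries _)) := by
      intro a
      rw [fall, Finset.prod_range_succ, map_mul, map_sub, map_natCast]
      rfl
    intro m
    induction m with
    | zero =>
      simp only [Finset.sum_range_one, zero_add, hf N]
      simp only [invFall, Finset.range_zero, Finset.prod_empty, map_sub, map_natCast]
      push_cast
      ring
    | succ m ih =>
      rw [Finset.sum_range_succ, add_mul, ih]
      have h1 : (invFall (m + 1) : PowerSeries (MvPolynomial (Fin (N + 1)) ℂ)) =
          invFall m * invLin (m : ℂ) := by rw [invFall, Finset.prod_range_succ, invFall]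
      have h2 := invLin_mul (R := MvPolynomial (Fin (N + 1)) ℂ) (m : ℂ)
      rw [map_natCast, map_natCast] at h2
      have h3 : m + 1 + N = m + N + 1 := by ring
      rw [h1, h3, hf (m + N + 1), map_sub, map_natCast]
      push_cast
      linear_combination PowerSeries.C (fall y (m + N + 1)) * invFall m * h2
  apply eq_of_dvd_all
  intro m
  have h1 := dvd_formalSum_sub _ hdvd (m + 1)
  obtain ⟨g, hg⟩ := h1
  rw [sub_eq_iff_eq_add] at hg
  rw [hg, add_mul, hpart m]
  obtain ⟨g', hg'⟩ := X_pow_dvd_invFall (R := MvPolynomial (Fin (N + 1)) ℂ) m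
  rw [hg']
  refine ⟨PowerSeries.X * g * (1 + PowerSeries.C (((N + 1 : ℕ) : MvPolynomial (Fin (N + 1)) ℂ) - y)
    * PowerSeries.X) - PowerSeries.X * PowerSeries.C (fall y (m + N + 1)) * g', ?_⟩
  ring

/-- The matrix `[(x_i + n - i)^{↓(n - j)}]` over power series. -/
noncomputable def baseMatrix : Matrix (Fin (N + 1)) (Fin (N + 1))
    (PowerSeries (MvPolynomial (Fin (N + 1)) ℂ)) :=
  Matrix.of fun i j => PowerSeries.C (fall (yvar (N + 1) i) (N + 1 - (j + 1)))

theorem cramer_eq (k : ℕ) :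
    Matrix.cramer (baseMatrix N) (fun i => PowerSeries.C (fall (yvar (N + 1) i) (k + N))) 0 =
      PowerSeries.C (alternant (N + 1) (fun _ => 0)) *
        PowerSeries.C (level (N + 1) (hStar k)) := by
  have h1 := shiftedSchur_mul (rowDiagram k) (N + 1)
    ((rowDiagram_colLen k).trans (by omega))
  have h2 : level (N + 1) (hStar k) * alternant (N + 1) (fun _ => 0) =
      alternant (N + 1) (rowDiagram k).rowLen := h1
  rw [← map_mul, mul_comm, h2, Matrix.cramer_apply, alternant, RingHom.map_det]
  congr 1
  ext1 i j
  rw [RingHom.mapMatrix_apply, Matrix.map_apply, Matrix.of_apply, rowDiagram_rowLen,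
    Matrix.updateCol_apply]
  split_ifs with h
  · subst h; simp [yvar]
  · have h' : (j : ℕ) ≠ 0 := fun e => h (Fin.ext e)
    simp [baseMatrix, yvar, h']

/-- The columns `∑_k (x_i + n - i)^{↓(k + n - 1)} / u^{↓k}`. -/
noncomputable def colSeries (i : Fin (N + 1)) : PowerSeries (MvPolynomial (Fin (N + 1)) ℂ) :=
  formalSum fun k => PowerSeries.C (fall (yvar (N + 1) i) (k + N)) * invFall k

theorem map_invFall {R S : Type*} [CommRing R] [Algebra ℂ R] [CommRing S] [Algebra ℂ S]
    (f : R →ₐ[ℂ] S) (k : ℕ) : PowerSeries.map (f : R →+* S) (invFall k) = invFall k := by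
  rw [invFall, map_prod, invFall]
  refine Finset.prod_congr rfl fun j _ => ?_
  rw [invLin, map_mul, PowerSeries.map_X, invLin]
  congr 1
  ext n
  simp

theorem cramer_colSeries :
    Matrix.cramer (baseMatrix N) (colSeries N) 0 =
      PowerSeries.C (alternant (N + 1) (fun _ => 0)) *
        PowerSeries.map (level (N + 1) : ShiftedSym →+* _) HStar := by
  apply eq_of_dvd_all
  intro m
  have h1 : ∀ i, ∃ g, colSeries N i = PowerSeries.X ^ m * g +
      ∑ k ∈ Finset.range m, PowerSeries.C (fall (yvar (N + 1) i) (k + N)) * invFall k := by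
    intro i
    obtain ⟨g, hg⟩ := dvd_formalSum_sub
      (fun k => PowerSeries.C (fall (yvar (N + 1) i) (k + N)) * invFall k)
      (fun k => Dvd.dvd.mul_left (X_pow_dvd_invFall k) _) m
    exact ⟨g, sub_eq_iff_eq_add.1 hg⟩
  choose g hg using h1
  have h2 : colSeries N = (PowerSeries.X ^ m : PowerSeries (MvPolynomial (Fin (N + 1)) ℂ)) • g +
      ∑ k ∈ Finset.range m, (invFall k : PowerSeries (MvPolynomial (Fin (N + 1)) ℂ)) •
        fun i => PowerSeries.C (fall (yvar (N + 1) i) (k + N)) := by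
    funext i
    rw [hg i, Pi.add_apply, Finset.sum_apply, Pi.smul_apply, smul_eq_mul]
    refine congrArg _ (Finset.sum_congr rfl fun k _ => ?_)
    rw [Pi.smul_apply, smul_eq_mul, mul_comm]
  obtain ⟨g', hg'⟩ := dvd_formalSum_sub (fun k => PowerSeries.C (hStar k) * invFall k)
      (fun k => Dvd.dvd.mul_left (X_pow_dvd_invFall k) _) m
  rw [sub_eq_iff_eq_add] at hg'
  have h3 : PowerSeries.map (level (N + 1) : ShiftedSym →+* _) HStar =
      PowerSeries.X ^ m * PowerSeries.map (level (N + 1) : ShiftedSym →+* _) g' +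
      ∑ k ∈ Finset.range m, PowerSeries.C (level (N + 1) (hStar k)) * invFall k := by
    rw [HStar, hg', map_add, map_mul, map_pow, PowerSeries.map_X, map_sum]
    congr 1
    refine Finset.sum_congr rfl fun k _ => ?_
    rw [map_mul, map_invFall, PowerSeries.map_C]
    rfl
  rw [h2, h3, map_add, map_smul, map_sum, Pi.add_apply, Finset.sum_apply]
  have h4 : ∀ k ∈ Finset.range m, Matrix.cramer (baseMatrix N)
      ((invFall k : PowerSeries (MvPolynomial (Fin (N + 1)) ℂ)) •
        fun i => PowerSeries.C (fall (yvar (N + 1) i) (k + N))) 0 =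
      PowerSeries.C (alternant (N + 1) (fun _ => 0)) *
        (PowerSeries.C (level (N + 1) (hStar k)) * invFall k) := by
    intro k _
    rw [map_smul, Pi.smul_apply, cramer_eq, smul_eq_mul]
    ring
  rw [Finset.sum_congr rfl h4, ← Finset.mul_sum, Pi.smul_apply, smul_eq_mul]
  refine ⟨Matrix.cramer (baseMatrix N) g 0 - PowerSeries.C (alternant (N + 1) (fun _ => 0)) *
    PowerSeries.map (level (N + 1) : ShiftedSym →+* _) g', ?_⟩
  ring

theorem HStar_level :
    PowerSeries.map (level (N + 1) : ShiftedSym →+* _) HStar *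
      ∏ i : Fin (N + 1), (1 - PowerSeries.C (X i - C ((i : ℂ) + 1)) * PowerSeries.X) =
      ∏ i : Fin (N + 1), (1 + PowerSeries.C (C ((i : ℂ) + 1)) * PowerSeries.X) := by
  set R := MvPolynomial (Fin (N + 1)) ℂ with hR
  set A := PowerSeries R with hA
  let K := FractionRing A
  let ι : A →+* K := algebraMap A K
  have hι : Function.Injective ι := IsFractionRing.injective A K
  set t : K := ι PowerSeries.X with ht
  have ht0 : t ≠ 0 := by
    rw [ht, ← map_zero ι]
    exact fun h => PowerSeries.X_ne_zero (hι h)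
  set y : Fin (N + 1) → K := fun i => ι (PowerSeries.C (yvar (N + 1) i)) with hy
  set w : K := t⁻¹ + (N + 1 : ℕ) with hw
  have htw : ∀ z : K, t * (w - z) = 1 + ((N + 1 : ℕ) - z) * t := by
    intro z
    have := mul_inv_cancel₀ ht0
    rw [hw]
    linear_combination this
  set Q := nodal y with hQ
  set P := fallPoly K N with hP
  set r := Q /ₘ (Polynomial.X - Polynomial.C w) with hr
  set q := P /ₘ (Polynomial.X - Polynomial.C w) with hq
  have hQr : (Polynomial.X - Polynomial.C w) * r = Q - Polynomial.C (Q.eval w) := by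
    have := Polynomial.modByMonic_add_div Q (Polynomial.X - Polynomial.C w)
    rw [Polynomial.modByMonic_X_sub_C_eq_C_eval] at this
    rw [← hr] at this
    linear_combination this
  have hPq : (Polynomial.X - Polynomial.C w) * q = P - Polynomial.C (P.eval w) := by
    have := Polynomial.modByMonic_add_div P (Polynomial.X - Polynomial.C w)
    rw [Polynomial.modByMonic_X_sub_C_eq_C_eval] at this
    rw [← hq] at this
    linear_combination this
  set T : Polynomial K := Polynomial.C (t ^ N * (1 + t)) *
    (Polynomial.C (P.eval w) * r - Polynomial.C (Q.eval w) * q) with hT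
  have hdegX : Polynomial.degree (Polynomial.X - Polynomial.C w) = 1 := Polynomial.degree_X_sub_C w
  have hPdeg : P.degree = N := by
    rw [Polynomial.degree_eq_natDegree (fallPoly_monic K N).ne_zero, fallPoly_natDegree]
  have hqdeg : q.degree < N := by
    rw [← hPdeg]
    exact Polynomial.degree_divByMonic_lt _ _ (fallPoly_monic K N).ne_zero (by rw [hdegX]; simp)
  have hQnat : Q.natDegree = N + 1 := by
    rw [Polynomial.natDegree_eq_of_degree_eq_some (nodal_degree y)]
  have hrnat : r.natDegree = N := by
    rw [hr, Polynomial.natDegree_divByMonic _ (Polynomial.monic_X_sub_C w), hQnat,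
      Polynomial.natDegree_X_sub_C]
    rfl
  have hrcoeff : r.coeff N = 1 := by
    have h1 : r.leadingCoeff = Q.leadingCoeff := by
      rw [hr]
      apply Polynomial.leadingCoeff_divByMonic_X_sub_C
      rw [nodal_degree]
      exact_mod_cast Nat.succ_ne_zero N
    rw [Polynomial.leadingCoeff, hrnat] at h1
    rw [h1]
    exact nodal_monic y
  have hTnat : T.natDegree ≤ N := by
    refine (Polynomial.natDegree_C_mul_le _ _).trans ?_
    refine (Polynomial.natDegree_sub_le _ _).trans (max_le ?_ ?_)
    · exact (Polynomial.natDegree_C_mul_le _ _).trans hrnat.le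
    · exact (Polynomial.natDegree_C_mul_le _ _).trans (Polynomial.natDegree_le_of_degree_le hqdeg.le)
  have hTcoeff : T.coeff N = t ^ N * (1 + t) * P.eval w := by
    rw [hT, Polynomial.coeff_C_mul, Polynomial.coeff_sub, Polynomial.coeff_C_mul,
      Polynomial.coeff_C_mul, hrcoeff, Polynomial.coeff_eq_zero_of_degree_lt hqdeg]
    ring
  have hlead : t ^ N * (1 + t) * P.eval w =
      ι (∏ i : Fin (N + 1), (1 + PowerSeries.C (C ((i : ℂ) + 1)) * PowerSeries.X)) := by
    rw [map_prod, Fin.prod_univ_eq_prod_range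
      (fun i : ℕ => ι (1 + PowerSeries.C (C ((i : ℂ) + 1)) * PowerSeries.X)),
      Finset.prod_range_succ', ← Finset.prod_range_reflect]
    have h1 : ∀ k : ℕ, ι (1 + PowerSeries.C (C ((k : ℂ) + 1)) * PowerSeries.X) =
        1 + ((k : K) + 1) * t := by
      intro k
      simp [ht]
    simp only [h1, hP, fallPoly_eval, fall]
    have h2 : t ^ N = ∏ _k ∈ Finset.range N, t := by simp
    rw [h2]
    have h3 : (∏ _k ∈ Finset.range N, t) * (1 + t) * (∏ k ∈ Finset.range N, (w - (k : K))) =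
        (∏ k ∈ Finset.range N, t * (w - (k : K))) * (1 + t) := by
      rw [Finset.prod_mul_distrib]; ring
    rw [h3]
    congr 1
    · refine Finset.prod_congr rfl fun k hk => ?_
      rw [htw]
      rw [Finset.mem_range] at hk
      have : ((N - 1 - k + 1 : ℕ) : K) + 1 = (N + 1 : ℕ) - (k : K) := by
        have h4 : N - 1 - k + 1 = N - k := by omega
        rw [h4, Nat.cast_sub hk.le]
        push_cast
        ring
      rw [this]
    · simp
  have hprod : t ^ (N + 1) * Q.eval w =
      ι (∏ i : Fin (N + 1), (1 - PowerSeries.C (X i - C ((i : ℂ) + 1)) * PowerSeries.X)) := by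
    rw [hQ, nodal, Polynomial.eval_prod, map_prod]
    have h2 : t ^ (N + 1) = ∏ _k : Fin (N + 1), t := by simp
    rw [h2, ← Finset.prod_mul_distrib]
    refine Finset.prod_congr rfl fun i _ => ?_
    rw [Polynomial.eval_sub, Polynomial.eval_X, Polynomial.eval_C, htw, hy]
    simp only [yvar, map_sub, map_add, map_mul, map_one, ht, map_natCast]
    push_cast
    ring
  have hTy : ∀ i, T.eval (y i) = t ^ (N + 1) * Q.eval w * ι (colSeries N i) := by
    intro i
    have h1 := congrArg ι (telescoping N (yvar (N + 1) i))
    have h1' : ι (colSeries N i) * (t * (w - y i)) = P.eval (y i) * (1 + t) := by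
      have e0 : fall (y i) N = ι (PowerSeries.C (fall (yvar (N + 1) i) N)) :=
        (map_fall (ι.comp PowerSeries.C) (yvar (N + 1) i) N).symm
      rw [htw, hP, fallPoly_eval, e0, hy]
      have e1 : (1 : K) + ((N + 1 : ℕ) - ι (PowerSeries.C (yvar (N + 1) i))) * t =
        ι (1 + PowerSeries.C (((N + 1 : ℕ) : R) - yvar (N + 1) i) * PowerSeries.X) := by
        simp [ht]
      have e2 : (1 + t) = ι (1 + PowerSeries.X) := by simp [ht]
      rw [e1, e2, ← map_mul, ← map_mul]
      exact h1
    have h2 := congrArg (Polynomial.eval (y i)) hQr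
    have h3 := congrArg (Polynomial.eval (y i)) hPq
    simp only [Polynomial.eval_mul, Polynomial.eval_sub, Polynomial.eval_X, Polynomial.eval_C] at h2 h3
    rw [hQ, nodal_eval, ← hQ] at h2
    rw [hT]
    simp only [Polynomial.eval_mul, Polynomial.eval_sub, Polynomial.eval_C]
    linear_combination t ^ N * (1 + t) * Polynomial.eval (y i) r * h3 -
      (t ^ N * (1 + t) * Polynomial.eval (y i) q + t ^ (N + 1) * ι (colSeries N i)) * h2 -
      t ^ N * Polynomial.eval (y i) r * h1'
  have hdet := det_eval_triangular y
    (fun j => if j = 0 then T else fallPoly K (N + 1 - (j + 1))) (by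
      intro j
      split_ifs with hj
      · subst hj; simpa using hTnat
      · rw [fallPoly_natDegree])
  have hcoef : ∏ j : Fin (N + 1), ((if j = 0 then T else fallPoly K (N + 1 - (j + 1))).coeff
      (N + 1 - (j + 1))) = T.coeff N := by
    rw [Fin.prod_univ_succ, Finset.prod_eq_one]
    · simp
    · intro j _
      rw [if_neg (Fin.succ_ne_zero j)]
      have := fallPoly_monic K (N + 1 - ((j.succ : Fin (N + 1)) + 1))
      rw [Polynomial.Monic, Polynomial.leadingCoeff, fallPoly_natDegree] at this
      exact this
  rw [hcoef, hTcoeff, hlead] at hdet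
  have hvdm : vdm y = ι (PowerSeries.C (alternant (N + 1) (fun _ => 0))) := by
    rw [alternant_zero_eq, vdm, vdm, RingHom.map_det, RingHom.map_det]
    congr 1
    ext1 i j
    simp [hy]
  have hM : Matrix.det (Matrix.of fun i j : Fin (N + 1) =>
      (if j = 0 then T else fallPoly K (N + 1 - (j + 1))).eval (y i)) =
      t ^ (N + 1) * Q.eval w * ι (Matrix.cramer (baseMatrix N) (colSeries N) 0) := by
    rw [Matrix.cramer_apply, RingHom.map_det, RingHom.mapMatrix_apply, Matrix.map_updateCol,
      ← Matrix.det_updateCol_smul]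
    congr 1
    ext1 i j
    rw [Matrix.updateCol_apply, Matrix.of_apply]
    split_ifs with hj
    · exact hTy i
    · rw [fallPoly_eval, Matrix.map_apply, baseMatrix, Matrix.of_apply]
      exact (map_fall (ι.comp PowerSeries.C) (yvar (N + 1) i) _).symm
  rw [hM, cramer_colSeries, hprod, hvdm, ← map_mul, ← map_mul] at hdet
  have hfin := hι hdet
  have hD : (PowerSeries.C (alternant (N + 1) (fun _ => 0)) : A) ≠ 0 := by
    rw [Ne, ← map_zero PowerSeries.C, PowerSeries.C_injective.eq_iff]
    exact (alternant_zero_degree _).1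
  apply mul_left_cancel₀ hD
  rw [← hfin]
  ring

end HStarProduct

/-! ### The generating series `H(u)` and `E(u)` of `Λ` -/

/-- `H(u) = 1 + ∑_{k ≥ 1} h_k / u^k = exp(∑_{k ≥ 1} p_k / (k u^k))` as a power series in `1/u`. -/
noncomputable def H : PowerSeries Lam :=
  (PowerSeries.exp Lam).subst (PowerSeries.mk fun k =>
    if hk : 0 < k then C (1 / (k : ℂ)) * X ⟨k, hk⟩ else 0 : PowerSeries Lam)

/-- `E(u) = 1 + ∑_{k ≥ 1} e_k / u^k = exp(∑_{k ≥ 1} (-1)^(k-1) p_k / (k u^k))` as a power series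
in `1/u`. -/
noncomputable def E : PowerSeries Lam :=
  (PowerSeries.exp Lam).subst (PowerSeries.mk fun k =>
    if hk : 0 < k then C ((-1) ^ (k - 1) / (k : ℂ)) * X ⟨k, hk⟩ else 0 : PowerSeries Lam)

/-- The series `f(u + c)` in `1/u`, for a series `f(u)` in `1/u`: substitute
`1/(u + c) = 1/(u - (-c))` for `1/u`. -/
noncomputable def translate (c : ℂ) (f : PowerSeries Lam) : PowerSeries Lam :=
  f.subst (invLin (-c) : PowerSeries Lam)

/-! ### The isomorphism `φ : Λ* → Λ` -/

theorem ode_unique {n : ℕ} {F G l : PowerSeries (MvPolynomial (Fin n) ℂ)}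
    (hF : PowerSeries.derivative _ F = l * F) (hG : PowerSeries.derivative _ G = l * G)
    (h0 : PowerSeries.constantCoeff F = PowerSeries.constantCoeff G) : F = G := by
  ext1 k
  induction k using Nat.strong_induction_on with
  | _ k ih =>
    cases k with
    | zero => simpa using h0
    | succ k =>
      have h1 := congrArg (PowerSeries.coeff k) hF
      have h2 := congrArg (PowerSeries.coeff k) hG
      rw [PowerSeries.coeff_derivative, PowerSeries.coeff_mul] at h1 h2
      have h3 : (∑ p ∈ Finset.HasAntidiagonal.antidiagonal k, PowerSeries.coeff p.1 l * PowerSeries.coeff p.2 F) =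
          ∑ p ∈ Finset.HasAntidiagonal.antidiagonal k, PowerSeries.coeff p.1 l * PowerSeries.coeff p.2 G := by
        refine Finset.sum_congr rfl fun p hp => ?_
        have := Finset.HasAntidiagonal.mem_antidiagonal.1 hp
        rw [ih p.2 (by omega)]
      rw [h3, ← h2] at h1
      have hk : ((k : MvPolynomial (Fin n) ℂ) + 1) ≠ 0 := by exact_mod_cast Nat.succ_ne_zero k
      exact mul_right_cancel₀ hk h1

theorem geom_mul {R : Type*} [CommRing R] (a : R) :
    (1 - PowerSeries.C a * PowerSeries.X) * (PowerSeries.mk fun n => a ^ n) = 1 := by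
  ext n
  cases n with
  | zero => simp [sub_mul]
  | succ n =>
    rw [sub_mul, one_mul, map_sub, mul_assoc, PowerSeries.coeff_C_mul,
      PowerSeries.coeff_succ_X_mul]
    simp [pow_succ', PowerSeries.coeff_one]

theorem derivative_prod {R : Type*} [CommRing R] {ι : Type*} (s : Finset ι) (a : ι → R) :
    PowerSeries.derivative R (∏ i ∈ s, (1 - PowerSeries.C (a i) * PowerSeries.X)) =
      (-∑ i ∈ s, PowerSeries.C (a i) * PowerSeries.mk fun n => a i ^ n) *
        ∏ i ∈ s, (1 - PowerSeries.C (a i) * PowerSeries.X) := by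
  classical
  induction s using Finset.induction_on with
  | empty => simp
  | insert i s hi ih =>
    have h1 : PowerSeries.derivative R (1 - PowerSeries.C (a i) * PowerSeries.X) =
        -PowerSeries.C (a i) := by
      simp
    have h2 := geom_mul (a i)
    rw [Finset.prod_insert hi, Finset.sum_insert hi, Derivation.leibniz, ih, h1, smul_eq_mul,
      smul_eq_mul]
    linear_combination (-PowerSeries.C (a i)) *
      (∏ i ∈ s, (1 - PowerSeries.C (a i) * PowerSeries.X)) * (-h2)

theorem level_psi_term (n : ℕ) (c : ℂ) (k : ℕ+) :
    (level n).comp psi (C c * X k) = C c * powLevel n k := by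
  have h1 : (level n).comp psi (C c) = C c := AlgHom.commutes _ _
  have h2 : (level n).comp psi (X k) = powLevel n k := by
    rw [AlgHom.comp_apply, psi, aeval_X]
    rfl
  rw [map_mul, h1, h2]

theorem map_H_level (n : ℕ) :
    PowerSeries.map (((level n).comp psi : Lam →ₐ[ℂ] _) : Lam →+* _) H =
      (PowerSeries.exp (MvPolynomial (Fin n) ℂ)).subst (PowerSeries.mk fun k =>
        if 0 < k then C (1 / (k : ℂ)) * powLevel n k else 0 :
          PowerSeries (MvPolynomial (Fin n) ℂ)) := by
  have hs : PowerSeries.HasSubst (PowerSeries.mk fun k =>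
      if hk : 0 < k then C (1 / (k : ℂ)) * X ⟨k, hk⟩ else 0 : PowerSeries Lam) := by
    apply PowerSeries.HasSubst.of_constantCoeff_zero'
    simp
  have hm : PowerSeries.map (((level n).comp psi : Lam →ₐ[ℂ] _) : Lam →+* _)
      (PowerSeries.mk fun k =>
        if hk : 0 < k then C (1 / (k : ℂ)) * X ⟨k, hk⟩ else 0 : PowerSeries Lam) =
      PowerSeries.mk fun k => if 0 < k then C (1 / (k : ℂ)) * powLevel n k else 0 := by
    ext1 k
    rw [PowerSeries.coeff_map, PowerSeries.coeff_mk, PowerSeries.coeff_mk]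
    split_ifs with hk
    · exact level_psi_term n _ _
    · exact map_zero _
  have hm2 := PowerSeries.map_subst hs (h := (((level n).comp psi : Lam →ₐ[ℂ] _) :
    Lam →+* MvPolynomial (Fin n) ℂ)) (PowerSeries.exp Lam)
  rw [PowerSeries.map_exp] at hm2
  rw [← hm]
  exact hm2

theorem exp_level (n : ℕ) :
    PowerSeries.map (((level n).comp psi : Lam →ₐ[ℂ] _) : Lam →+* _) H *
      ∏ i : Fin n, (1 - PowerSeries.C (X i - C ((i : ℂ) + 1 / 2)) * PowerSeries.X) =
      ∏ i : Fin n, (1 - PowerSeries.C (C (-((i : ℂ) + 1 / 2))) * PowerSeries.X) := by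
  set L : PowerSeries (MvPolynomial (Fin n) ℂ) :=
    PowerSeries.mk fun k => if 0 < k then C (1 / (k : ℂ)) * powLevel n k else 0 with hL
  have hLs : PowerSeries.HasSubst L := by
    apply PowerSeries.HasSubst.of_constantCoeff_zero'
    simp [hL]
  rw [map_H_level, ← hL]
  set G := (PowerSeries.exp (MvPolynomial (Fin n) ℂ)).subst L with hG
  have hGd : PowerSeries.derivative _ G = G * PowerSeries.derivative _ L := by
    rw [hG, PowerSeries.derivative_subst hLs, PowerSeries.derivative_exp]
  have hG0 : PowerSeries.constantCoeff G = 1 := by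
    have h1 : PowerSeries.exp (MvPolynomial (Fin n) ℂ) =
        1 + (PowerSeries.exp (MvPolynomial (Fin n) ℂ) - 1) := by ring
    rw [hG, h1, PowerSeries.subst_add hLs, map_add]
    have h2 := PowerSeries.constantCoeff_subst_eq_zero (a := L) (by
      change PowerSeries.constantCoeff L = 0
      simp [hL]) (PowerSeries.exp (MvPolynomial (Fin n) ℂ) - 1) (by simp)
    have h3 : PowerSeries.subst L (1 : PowerSeries (MvPolynomial (Fin n) ℂ)) = 1 := by
      rw [← PowerSeries.coe_substAlgHom hLs, map_one]
    rw [h3]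
    have h2' : PowerSeries.constantCoeff (PowerSeries.subst L
      (PowerSeries.exp (MvPolynomial (Fin n) ℂ) - 1)) = 0 := h2
    rw [h2']
    simp
  set a : Fin n → MvPolynomial (Fin n) ℂ := fun i => X i - C ((i : ℂ) + 1 / 2) with ha
  set b : Fin n → MvPolynomial (Fin n) ℂ := fun i => C (-((i : ℂ) + 1 / 2)) with hb
  have hLd : PowerSeries.derivative _ L =
      (∑ i, PowerSeries.C (a i) * PowerSeries.mk fun n => a i ^ n) -
      ∑ i, PowerSeries.C (b i) * PowerSeries.mk fun n => b i ^ n := by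
    ext1 k
    rw [PowerSeries.coeff_derivative, hL, PowerSeries.coeff_mk, if_pos (Nat.succ_pos k), map_sub,
      map_sum, map_sum, ← Finset.sum_sub_distrib, powLevel, Finset.mul_sum, Finset.sum_mul]
    refine Finset.sum_congr rfl fun i _ => ?_
    rw [PowerSeries.coeff_C_mul, PowerSeries.coeff_C_mul, PowerSeries.coeff_mk,
      PowerSeries.coeff_mk, ha, hb]
    have hk : C (1 / ((k + 1 : ℕ) : ℂ)) * ((k : MvPolynomial (Fin n) ℂ) + 1) = 1 := by
      have : ((k : MvPolynomial (Fin n) ℂ) + 1) = C (((k + 1 : ℕ) : ℂ)) := by simp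
      rw [this, ← C_mul, one_div_mul_cancel (by exact_mod_cast Nat.succ_ne_zero k), C_1]
    rw [map_pow]
    simp only
    linear_combination ((X i - C ((i : ℂ) + 1 / 2)) ^ (k + 1) -
      (C (-((i : ℂ) + 1 / 2)) : MvPolynomial (Fin n) ℂ) ^ (k + 1)) * hk
  refine ode_unique (l := -∑ i, PowerSeries.C (b i) * PowerSeries.mk fun n => b i ^ n) ?_ ?_ ?_
  · rw [Derivation.leibniz, hGd, hLd]
    have := derivative_prod Finset.univ a
    simp only [smul_eq_mul]
    rw [this]
    ring
  · exact derivative_prod Finset.univ b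
  · rw [map_mul, hG0]
    simp [map_prod]

theorem hasSubst_invLin {R : Type*} [CommRing R] [Algebra ℂ R] (c : ℂ) :
    PowerSeries.HasSubst (invLin c : PowerSeries R) := by
  apply PowerSeries.HasSubst.of_constantCoeff_zero'
  simp [invLin]

theorem subst_prod {R : Type*} [CommRing R] [Algebra ℂ R] (n : ℕ) (c : Fin n → R) :
    PowerSeries.subst (invLin (-(1 / 2)) : PowerSeries R)
      (∏ i, (1 - PowerSeries.C (c i) * PowerSeries.X)) *
        (∏ _i : Fin n, (1 + PowerSeries.C (algebraMap ℂ R (1 / 2)) * PowerSeries.X)) =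
      ∏ i, (1 - PowerSeries.C (c i - algebraMap ℂ R (1 / 2)) * PowerSeries.X) := by
  have hs := hasSubst_invLin (R := R) (-(1 / 2))
  rw [← PowerSeries.coe_substAlgHom (R := R) hs, map_prod, ← Finset.prod_mul_distrib]
  refine Finset.prod_congr rfl fun i _ => ?_
  rw [map_sub, map_one, map_mul, PowerSeries.substAlgHom_X, PowerSeries.coe_substAlgHom]
  have h3 : PowerSeries.subst (invLin (-(1 / 2)) : PowerSeries R) (PowerSeries.C (c i)) =
    PowerSeries.C (c i) := PowerSeries.subst_C _
  rw [h3]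
  have h4 := invLin_mul (R := R) (-(1 / 2))
  rw [map_neg, map_neg] at h4
  rw [map_sub]
  linear_combination (-PowerSeries.C (c i)) * h4

theorem subst_ratio {R : Type*} [CommRing R] [Algebra ℂ R] (n : ℕ) (a b : Fin n → R)
    (G : PowerSeries R)
    (hG : G * ∏ i, (1 - PowerSeries.C (a i) * PowerSeries.X) =
      ∏ i, (1 - PowerSeries.C (b i) * PowerSeries.X)) :
    PowerSeries.subst (invLin (-(1 / 2)) : PowerSeries R) G *
      ∏ i, (1 - PowerSeries.C (a i - algebraMap ℂ R (1 / 2)) * PowerSeries.X) =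
      ∏ i, (1 - PowerSeries.C (b i - algebraMap ℂ R (1 / 2)) * PowerSeries.X) := by
  have hs := hasSubst_invLin (R := R) (-(1 / 2))
  rw [← subst_prod, ← subst_prod, ← hG, PowerSeries.subst_mul hs, mul_assoc]

theorem map_translate (n : ℕ) :
    PowerSeries.map (((level n).comp psi : Lam →ₐ[ℂ] _) : Lam →+* MvPolynomial (Fin n) ℂ) (translate (1 / 2) H) =
      PowerSeries.subst (invLin (-(1 / 2)) : PowerSeries (MvPolynomial (Fin n) ℂ))
        (PowerSeries.map (((level n).comp psi : Lam →ₐ[ℂ] _) : Lam →+* MvPolynomial (Fin n) ℂ) H) := by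
  have h := PowerSeries.map_subst (hasSubst_invLin (R := Lam) (-(1 / 2)))
    (h := (((level n).comp psi : Lam →ₐ[ℂ] _) : Lam →+* MvPolynomial (Fin n) ℂ)) H
  have h2 : PowerSeries.map (((level n).comp psi : Lam →ₐ[ℂ] _) : Lam →+* MvPolynomial (Fin n) ℂ)
      (invLin (-(1 / 2))) = invLin (-(1 / 2)) := by
    rw [invLin, invLin, map_mul, PowerSeries.map_X]
    congr 1
    ext1 k
    simp only [PowerSeries.coeff_map, PowerSeries.coeff_mk]
    exact AlgHom.commutes ((level n).comp psi) _
  rw [← h2]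
  exact h

theorem map_psi_level (N : ℕ) :
    PowerSeries.map (((level (N + 1)).comp psi : Lam →ₐ[ℂ] _) : Lam →+* _) (translate (1 / 2) H) =
      PowerSeries.map (level (N + 1) : ShiftedSym →+* MvPolynomial (Fin (N + 1)) ℂ) HStar := by
  have h1 := subst_ratio (N + 1) _ _ _ (exp_level (N + 1))
  rw [← map_translate] at h1
  have ha : ∀ i : Fin (N + 1), (X i - C ((i : ℂ) + 1 / 2) - algebraMap ℂ _ (1 / 2) :
      MvPolynomial (Fin (N + 1)) ℂ) = X i - C ((i : ℂ) + 1) := by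
    intro i
    rw [algebraMap_eq, sub_sub, ← C_add]
    congr 2
    ring
  have hb : ∀ i : Fin (N + 1), (1 - PowerSeries.C (C (-((i : ℂ) + 1 / 2)) -
      algebraMap ℂ (MvPolynomial (Fin (N + 1)) ℂ) (1 / 2)) * PowerSeries.X) =
      1 + PowerSeries.C (C ((i : ℂ) + 1)) * PowerSeries.X := by
    intro i
    have : (C (-((i : ℂ) + 1 / 2)) - algebraMap ℂ (MvPolynomial (Fin (N + 1)) ℂ) (1 / 2)) =
        -C ((i : ℂ) + 1) := by
      rw [algebraMap_eq, ← C_sub, ← C_neg]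
      congr 1
      ring
    rw [this, map_neg]
    ring
  rw [Finset.prod_congr rfl fun i _ => by rw [ha i], Finset.prod_congr rfl fun i _ => hb i,
    ← HStar_level] at h1
  refine mul_right_cancel₀ (Finset.prod_ne_zero_iff.2 fun i _ h0 => ?_) h1
  have := congrArg PowerSeries.constantCoeff h0
  simp at this

theorem map_psi_translate :
    PowerSeries.map (psi : Lam →+* ShiftedSym) (translate (1 / 2) H) = HStar := by
  ext1 k
  apply level_ext
  have h1 : ∀ N, level (N + 1) (PowerSeries.coeff k (PowerSeries.map (psi : Lam →+* ShiftedSym)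
      (translate (1 / 2) H))) = level (N + 1) (PowerSeries.coeff k HStar) := fun N => by
    have := congrArg (PowerSeries.coeff k) (map_psi_level N)
    rw [PowerSeries.coeff_map, PowerSeries.coeff_map] at this
    rw [PowerSeries.coeff_map]
    exact this
  intro n
  exact level_eq_of_le (Nat.le_succ n) (h1 n)

theorem translate_injective : Function.Injective (translate (1 / 2)) := by
  have hθ := hasSubst_invLin (R := Lam) (1 / 2)
  have hθ' := hasSubst_invLin (R := Lam) (-(1 / 2))
  have h1 := invLin_mul (R := Lam) (1 / 2)
  have h2 := congrArg (PowerSeries.substAlgHom (R := Lam) hθ) (invLin_mul (R := Lam) (-(1 / 2)))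
  rw [map_mul, map_sub, map_one, map_mul, PowerSeries.substAlgHom_X, map_neg, map_neg] at h2
  have h3 : PowerSeries.substAlgHom (R := Lam) hθ
      (-PowerSeries.C (algebraMap ℂ Lam (1 / 2))) =
      -PowerSeries.C (algebraMap ℂ Lam (1 / 2)) := by
    rw [map_neg, PowerSeries.coe_substAlgHom]
    exact congrArg _ (PowerSeries.subst_C _)
  rw [h3] at h2
  have h4 : PowerSeries.substAlgHom (R := Lam) hθ (invLin (-(1 / 2))) = PowerSeries.X := by
    have hne : (1 + PowerSeries.C (algebraMap ℂ Lam (1 / 2)) * invLin (1 / 2)) ≠ 0 := by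
      intro h0
      have := congrArg PowerSeries.constantCoeff h0
      simp [invLin] at this
    apply mul_right_cancel₀ hne
    linear_combination h2 + h1
  rw [PowerSeries.coe_substAlgHom] at h4
  have h5 : Function.LeftInverse (PowerSeries.subst (invLin (1 / 2) : PowerSeries Lam))
      (translate (1 / 2)) := by
    intro f
    rw [translate, PowerSeries.subst_comp_subst_apply hθ' hθ, h4, PowerSeries.X_subst]
  exact h5.injective

theorem alpha_eq_id (α : Lam →ₐ[ℂ] Lam)
    (hα : PowerSeries.map (α : Lam →+* Lam) (translate (1 / 2) H) = translate (1 / 2) H) :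
    α = AlgHom.id ℂ Lam := by
  have h1 : PowerSeries.map (α : Lam →+* Lam) H = H := by
    apply translate_injective
    rw [← hα]
    symm
    have h := PowerSeries.map_subst (hasSubst_invLin (R := Lam) (-(1 / 2)))
      (h := (α : Lam →+* Lam)) H
    have h2 : PowerSeries.map (α : Lam →+* Lam) (invLin (-(1 / 2))) = invLin (-(1 / 2)) := by
      rw [invLin, map_mul, PowerSeries.map_X]
      congr 1
      ext1 k
      simp only [PowerSeries.coeff_map, PowerSeries.coeff_mk]
      exact AlgHom.commutes α _
    refine Eq.trans h ?_
    change PowerSeries.subst (PowerSeries.map (α : Lam →+* Lam) (invLin (-(1 / 2)))) _ = _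
    rw [h2]
    rfl
  set L : PowerSeries Lam := PowerSeries.mk fun k =>
    if hk : 0 < k then C (1 / (k : ℂ)) * X ⟨k, hk⟩ else 0 with hL
  have hs : PowerSeries.HasSubst L := by
    apply PowerSeries.HasSubst.of_constantCoeff_zero'
    simp [hL]
  have hd : PowerSeries.derivative _ H = H * PowerSeries.derivative _ L := by
    rw [H, PowerSeries.derivative_subst hs, PowerSeries.derivative_exp]
  have hmd : ∀ f : PowerSeries Lam, PowerSeries.map (α : Lam →+* Lam)
      (PowerSeries.derivative _ f) = PowerSeries.derivative _
        (PowerSeries.map (α : Lam →+* Lam) f) := by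
    intro f
    ext1 k
    simp [PowerSeries.coeff_derivative]
  have hd2 := congrArg (PowerSeries.map (α : Lam →+* Lam)) hd
  rw [map_mul, hmd, h1, hd] at hd2
  have hH : H ≠ 0 := by
    intro h0
    have h := map_H_level 0
    have h2 : PowerSeries.HasSubst (PowerSeries.mk fun k =>
        if 0 < k then C (1 / (k : ℂ)) * powLevel 0 k else 0 :
          PowerSeries (MvPolynomial (Fin 0) ℂ)) := by
      apply PowerSeries.HasSubst.of_constantCoeff_zero'
      simp
    have h3 := exp_level 0
    rw [h0] at h3
    simp at h3
  have hL' := mul_left_cancel₀ hH hd2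
  apply algHom_ext
  intro k
  obtain ⟨k, hk⟩ := k
  have h4 := congrArg (PowerSeries.coeff (k - 1)) hL'
  rw [PowerSeries.coeff_map, PowerSeries.coeff_derivative, hL, PowerSeries.coeff_mk] at h4
  have hk1 : k - 1 + 1 = k := Nat.sub_add_cancel hk
  have hkc : (((k - 1 : ℕ) : Lam) + 1) = C (k : ℂ) := by
    have : (((k - 1 : ℕ) : Lam) + 1) = ((k - 1 + 1 : ℕ) : Lam) := by push_cast; rfl
    rw [this, hk1]
    simp
  have hk0 : (k : ℂ) ≠ 0 := by exact_mod_cast Nat.pos_iff_ne_zero.1 hk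
  rw [dif_pos (by omega), hkc] at h4
  simp only [hk1] at h4
  have h5 : C (1 / (k : ℂ)) * X ⟨k, hk⟩ * C (k : ℂ) = (X ⟨k, hk⟩ : Lam) := by
    rw [mul_right_comm, ← C_mul, one_div_mul_cancel hk0, C_1, one_mul]
  rw [h5] at h4
  exact h4.symm

/-- There is exactly one algebra isomorphism `φ : Λ* → Λ` with `φ(H*(u)) = H(u + 1/2)`. -/
theorem existsUnique_phi : ∃! φ : ShiftedSym ≃ₐ[ℂ] Lam,
    PowerSeries.map (φ : ShiftedSym →+* Lam) HStar = translate (1 / 2) H := by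
  refine ⟨(AlgEquiv.ofBijective psi ⟨psi_injective, psi_surjective⟩).symm, ?_, ?_⟩
  · dsimp only
    rw [← map_psi_translate]
    ext1 k
    rw [PowerSeries.coeff_map, PowerSeries.coeff_map]
    exact (AlgEquiv.ofBijective psi ⟨psi_injective, psi_surjective⟩).symm_apply_apply _
  · intro φ hφ
    have h1 : (φ : ShiftedSym →ₐ[ℂ] Lam).comp psi = AlgHom.id ℂ Lam := by
      apply alpha_eq_id
      rw [← map_psi_translate] at hφ
      refine Eq.trans ?_ hφ
      ext1 k
      simp only [PowerSeries.coeff_map]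
      rfl
    ext1 f
    obtain ⟨P, rfl⟩ := psi_surjective f
    have h2 : φ (psi P) = P := DFunLike.congr_fun h1 P
    rw [h2]
    exact ((AlgEquiv.ofBijective psi ⟨psi_injective, psi_surjective⟩).symm_apply_apply P).symm

/-- The isomorphism `φ : Λ* → Λ` determined by `φ(H*(u)) = H(u + 1/2)`. -/
noncomputable def phi : ShiftedSym ≃ₐ[ℂ] Lam := existsUnique_phi.choose

theorem phi_HStar :
    PowerSeries.map (phi : ShiftedSym →+* Lam) HStar = translate (1 / 2) H :=
  existsUnique_phi.choose_spec.1

/-! ### Frobenius–Schur functions and their generating series -/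

/-- The Frobenius–Schur function `Fs_μ = φ(s*_μ) ∈ Λ`. -/
noncomputable def Fs (μ : YoungDiagram) : Lam := phi (shiftedSchur μ)

/-- The hook diagram `(p | q) = (p + 1, 1^q)`. -/
def hook (p q : ℕ) : YoungDiagram where
  cells := {0} ×ˢ Finset.range (p + 1) ∪ Finset.range (q + 1) ×ˢ {0}
  isLowerSet := by
    rintro ⟨a, b⟩ ⟨c, d⟩ ⟨h1, h2⟩ h
    simp only [Finset.coe_union, Finset.coe_product, Finset.coe_singleton, Finset.coe_range,
      Set.mem_union, Set.mem_prod, Set.mem_singleton_iff, Set.mem_Iio] at h ⊢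
    simp only at h1 h2
    omega

/-- `1 / ((u - 1/2) (u - 3/2) ⋯ (u - (2k-1)/2))` as a power series in `1/u`. -/
noncomputable def invHalf (k : ℕ) : PowerSeries Lam :=
  ∏ j ∈ Finset.range k, invLin ((2 * (j : ℂ) + 1) / 2)

/-- `Λ[[1/u, 1/v]]`. The variable `0` is `1/u` and the variable `1` is `1/v`. -/
abbrev Lam2 : Type := MvPowerSeries (Fin 2) Lam

/-- `f(u)` as an element of `Λ[[1/u, 1/v]]`, for a series `f` in one variable. -/
noncomputable def atU (f : PowerSeries Lam) : Lam2 := f.subst (MvPowerSeries.X 0 : Lam2)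

/-- `f(v)` as an element of `Λ[[1/u, 1/v]]`, for a series `f` in one variable. -/
noncomputable def atV (f : PowerSeries Lam) : Lam2 := f.subst (MvPowerSeries.X 1 : Lam2)

/-- The sum `∑_{p,q} f_{p,q}` of series in `1/u, 1/v` such that `f_{p,q}` is divisible by
`u^{-p} v^{-q}`: the coefficient of `u^{-a} v^{-b}` only involves `p ≤ a`, `q ≤ b`. -/
noncomputable def formalSum2 (f : ℕ → ℕ → Lam2) : Lam2 := fun m =>
  ∑ p ∈ Finset.range (m 0 + 1), ∑ q ∈ Finset.range (m 1 + 1), MvPowerSeries.coeff m (f p q)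

/-- `∑_{p,q ≥ 0} Fs_{(p|q)} / ((u-1/2) ⋯ (u-(2p+1)/2) (v-1/2) ⋯ (v-(2q+1)/2))`. -/
noncomputable def hookSeries : Lam2 :=
  formalSum2 fun p q =>
    MvPowerSeries.C (Fs (hook p q)) * atU (invHalf (p + 1)) * atV (invHalf (q + 1))

/-- The ring obtained from `Λ[[1/u, 1/v]]` by inverting `1/u` and `1/v`; it contains `u`, `v`. -/
abbrev Laurent2 : Type :=
  Localization.Away (MvPowerSeries.X 0 * MvPowerSeries.X 1 : Lam2)

/-- The inclusion of `Λ[[1/u, 1/v]]`. -/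
noncomputable abbrev incl : Lam2 →+* Laurent2 := algebraMap Lam2 Laurent2

/-- `u = (1/v) / ((1/u) (1/v))`. -/
noncomputable def u : Laurent2 :=
  Localization.mk (MvPowerSeries.X 1)
    ⟨MvPowerSeries.X 0 * MvPowerSeries.X 1, Submonoid.mem_powers _⟩

/-- `v = (1/u) / ((1/u) (1/v))`. -/
noncomputable def v : Laurent2 :=
  Localization.mk (MvPowerSeries.X 0)
    ⟨MvPowerSeries.X 0 * MvPowerSeries.X 1, Submonoid.mem_powers _⟩

theorem u_mul : u * incl (MvPowerSeries.X 0) = 1 := by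
  rw [u, incl, ← Localization.mk_one_eq_algebraMap, Localization.mk_mul, mul_one,
    Localization.mk_eq_mk_iff.2 (Localization.r_of_eq (by
      change (1 : Lam2) * _ = _ * (1 : Lam2)
      ring) : Localization.r _ (_, _) ((1 : Lam2), 1))]
  exact Localization.mk_one

theorem v_mul : v * incl (MvPowerSeries.X 1) = 1 := by
  rw [v, incl, ← Localization.mk_one_eq_algebraMap, Localization.mk_mul, mul_one]
  exact Localization.mk_self ⟨MvPowerSeries.X 0 * MvPowerSeries.X 1, Submonoid.mem_powers _⟩

end FrobeniusSchur

namespace FrobeniusSchur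

open MvPolynomial

/-! ### Hook shifted Schur functions in finitely many variables -/

/-! Everything rests on one reading of hook functions. In `n` variables put `y_i = x_i + n - i`, and
expand `y_i^{↓(n+p)}` in the falling powers `y_i^{↓(n-1)}, …, y_i^{↓0}` with coefficients that do
not depend on `i`. By Cramer's rule the coefficient of `y_i^{↓(n-1-q)}` is a ratio of determinants.
Moving the replaced column to the front turns the numerator into the alternant of the hook, so the
coefficient is `(-1)^q s*_{(p|q)}` (`cramer_fallMatrix`, `fall_eq_sum_hook`). Multiplying the
expansion by `y - (n+p)` produces the one for `p + 1`. The overflowing term `y^{↓n}` is reduced by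
the expansion for `p = 0`, which is where the product `s*_{(p|0)} s*_{(0|q)}` comes from. Comparing
coefficients gives the recurrence (`level_hook_recurrence`), and `φ`, being an algebra map, carries
it to `Λ` (`Fs_hook_recurrence`).

For the generating series, write `u + v = (u - p - 1/2) + (v - q - 1/2) + (p + q + 1)`. The first
two summands each cancel one linear factor of a denominator, and the recurrence replaces the third.
What remains is a product term plus two telescoping differences (`sum_hook_telescope`). The double
series therefore factors as the product of a series in `u` built on the `Fs_{(p|0)}` and a series in
`v` built on the `Fs_{(0|q)}` (`hookSeries_mul`). The identity is proved after multiplication by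
`1/(uv)`, so that it lives among power series in `1/u, 1/v`.

It remains to name the factors. The row factor is `H(u)`: this is the condition `φ(H*(u)) = H(u +
1/2)` with the translation undone (`H_eq`). The column factor needs no computation: at `v = -u` the
factor `u + v` vanishes, so the column factor at `-u` is inverse to `H(u)` (`H_mul_columnSeries`).
The exponential formulas say the same of `E` (`H_mul_E`), hence the two agree (`columnSeries_eq_E`).
-/

theorem mem_hook {p q i j : ℕ} :
    (i, j) ∈ hook p q ↔ (i = 0 ∧ j < p + 1) ∨ (i < q + 1 ∧ j = 0) := by
  rw [← YoungDiagram.mem_cells]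
  simp only [hook, Finset.mem_union, Finset.mem_product, Finset.mem_singleton, Finset.mem_range]

theorem hook_rowLen (p q i : ℕ) :
    (hook p q).rowLen i = if i = 0 then p + 1 else if i ≤ q then 1 else 0 := by
  apply eq_of_forall_lt_iff
  intro j
  rw [← YoungDiagram.mem_iff_lt_rowLen, mem_hook]
  split_ifs <;> omega

theorem hook_colLen (p q : ℕ) : (hook p q).colLen 0 = q + 1 := by
  apply eq_of_forall_lt_iff
  intro j
  rw [← YoungDiagram.mem_iff_lt_colLen, mem_hook]
  omega

theorem hook_zero (p : ℕ) : hook p 0 = rowDiagram (p + 1) := by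
  ext ⟨i, j⟩
  rw [YoungDiagram.mem_cells, mem_hook]
  simp only [rowDiagram, Finset.mem_product, Finset.mem_singleton, Finset.mem_range]
  omega

theorem fall_succ {R : Type*} [CommRing R] (y : R) (m : ℕ) :
    fall y (m + 1) = fall y m * (y - m) :=
  Finset.prod_range_succ _ _

/-- The matrix `[(x_i + n - i)^{↓(n - j)}]`, whose determinant is the denominator of `s*_μ`. -/
noncomputable def fallMatrix (n : ℕ) : Matrix (Fin n) (Fin n) (MvPolynomial (Fin n) ℂ) :=
  Matrix.of fun i j => fall (yvar n i) (n - (j + 1))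

theorem det_fallMatrix (n : ℕ) : (fallMatrix n).det = alternant n (fun _ => 0) := by
  simp only [alternant, zero_add]
  rfl

/-- Replacing the column of exponent `n - 1 - q` by the exponent `n + p` leaves exactly the
exponents of the hook, except that the new column stands in position `q` instead of `0`. Moving it
to the front is a cycle of sign `(-1)^q`. -/
theorem cramer_fallMatrix (n p : ℕ) (q : Fin n) :
    Matrix.cramer (fallMatrix n) (fun i => fall (yvar n i) (n + p)) q =
      (-1) ^ (q : ℕ) * alternant n (hook p q).rowLen := by
  have hn : NeZero n := ⟨by have := q.2; omega⟩
  have hsign : (-1) ^ (q : ℕ) = (((Equiv.Perm.sign q.cycleRange : ℤˣ) : ℤ) :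
      MvPolynomial (Fin n) ℂ) := by
    rw [Fin.sign_cycleRange]
    push_cast
    rfl
  rw [Matrix.cramer_apply, alternant, hsign, ← Matrix.det_permute']
  congr 1
  ext1 i j
  rw [Matrix.updateCol_apply, Matrix.submatrix_apply, Matrix.of_apply, hook_rowLen]
  -- `q.cycleRange` sends `j < q` to `j + 1`, sends `q` to `0` and fixes `j > q`. For `j < q` the
  -- row length `1` of the hook compensates the shift of the column index.
  rcases lt_trichotomy j q with h | rfl | h
  · have h1 := Fin.coe_cycleRange_of_lt h
    have h2 : (j : ℕ) < q := h
    rw [if_neg h.ne, h1, if_neg (by omega), if_pos (by omega), fallMatrix, Matrix.of_apply]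
    have : 1 + (n - (j + 1 + 1)) = n - ((j : ℕ) + 1) := by have := q.2; omega
    rw [this]
    rfl
  · rw [if_pos rfl, Fin.cycleRange_self, Fin.val_zero, if_pos rfl]
    have : p + 1 + (n - (0 + 1)) = n + p := by have := j.2; omega
    rw [this]
    rfl
  · have h2 : (q : ℕ) < j := h
    rw [if_neg h.ne', Fin.cycleRange_of_gt h, if_neg (by omega), if_neg (by omega), zero_add]
    rfl

theorem level_shiftedSchur_mul (μ : YoungDiagram) (n : ℕ) (hn : μ.colLen 0 ≤ n) :
    level n (shiftedSchur μ) * alternant n (fun _ => 0) = alternant n μ.rowLen :=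
  shiftedSchur_mul μ n hn

theorem level_shiftedSchur_eq_zero (μ : YoungDiagram) (n : ℕ) (hn : n < μ.colLen 0) :
    level n (shiftedSchur μ) = 0 :=
  if_neg hn.not_ge

/-- The reduction of `y^{↓(n + p)}` modulo `∏ (y - y_i)` in the basis of falling powers. -/
theorem fall_eq_sum_hook (n p : ℕ) (i : Fin n) :
    fall (yvar n i) (n + p) = ∑ j ∈ Finset.range n,
      (-1) ^ j * level n (shiftedSchur (hook p j)) * fall (yvar n i) (n - (j + 1)) := by
  -- Cramer's rule with the denominator cleared. The determinant is nonzero in a domain, so it can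
  -- be cancelled afterwards.
  have h := congrFun (Matrix.mulVec_cramer (fallMatrix n) fun i => fall (yvar n i) (n + p)) i
  have hD := (alternant_zero_degree n).1
  rw [Pi.smul_apply, det_fallMatrix, smul_eq_mul] at h
  apply mul_left_cancel₀ hD
  rw [← h, Finset.mul_sum, Finset.sum_range, Matrix.mulVec, dotProduct]
  refine Finset.sum_congr rfl fun j _ => ?_
  rw [cramer_fallMatrix, ← level_shiftedSchur_mul _ n (by rw [hook_colLen]; exact j.2),
    fallMatrix, Matrix.of_apply]
  ring

/-- The falling powers are the columns of a matrix with nonzero determinant over a domain. This is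
what permits comparison of coefficients in expansions of this kind. -/
theorem eq_zero_of_sum_fall (n : ℕ) (d : ℕ → MvPolynomial (Fin n) ℂ)
    (h : ∀ i, ∑ j ∈ Finset.range n, d j * fall (yvar n i) (n - (j + 1)) = 0) (j : ℕ)
    (hj : j < n) : d j = 0 := by
  have h1 : (fallMatrix n).mulVec (fun j : Fin n => d j) = 0 := by
    funext i
    have := h i
    rw [Finset.sum_range] at this
    rw [Pi.zero_apply, ← this, Matrix.mulVec, dotProduct]
    exact Finset.sum_congr rfl fun j _ => mul_comm _ _
  exact congrFun (Matrix.eq_zero_of_mulVec_eq_zero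
    (by rw [det_fallMatrix]; exact (alternant_zero_degree n).1) h1) ⟨j, hj⟩

/-- The expansion of `y^{↓(n+p+1)}` is computed in two ways: directly, and as `y - (n + p)` times
the expansion of `y^{↓(n+p)}`. The product on the right arises from reducing `y^{↓n}`. -/
theorem level_hook_recurrence (n p q : ℕ) (hq : q < n) :
    level n (shiftedSchur (hook (p + 1) q)) + level n (shiftedSchur (hook p (q + 1))) +
        ((p + q + 1 : ℕ) : MvPolynomial (Fin n) ℂ) * level n (shiftedSchur (hook p q)) =
      level n (shiftedSchur (hook p 0)) * level n (shiftedSchur (hook 0 q)) := by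
  set c : ℕ → ℕ → MvPolynomial (Fin n) ℂ :=
    fun p j => (-1) ^ j * level n (shiftedSchur (hook p j)) with hc
  -- The hook `(p|n)` has `n + 1` rows, too many for `n` variables. This makes the shifted sum in
  -- `htel` end at the right place.
  have hcn : c p n = 0 := by
    rw [hc]
    simp only
    rw [level_shiftedSchur_eq_zero _ _ (by rw [hook_colLen]; omega), mul_zero]
  have hd : c (p + 1) q - c p 0 * c 0 q - c p (q + 1) + (p + q + 1 : ℕ) * c p q = 0 := by
    refine eq_zero_of_sum_fall n
      (fun j => c (p + 1) j - c p 0 * c 0 j - c p (j + 1) + (p + j + 1 : ℕ) * c p j)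
      (fun i => ?_) q hq
    set y := yvar n i
    have h0 : fall y n = ∑ j ∈ Finset.range n, c 0 j * fall y (n - (j + 1)) :=
      fall_eq_sum_hook n 0 i
    have hp : fall y (n + p) = ∑ j ∈ Finset.range n, c p j * fall y (n - (j + 1)) :=
      fall_eq_sum_hook n p i
    have hp1 : fall y (n + p + 1) = ∑ j ∈ Finset.range n, c (p + 1) j * fall y (n - (j + 1)) :=
      fall_eq_sum_hook n (p + 1) i
    -- With `k = n - (j + 1)`, this splits `y - (n + p)` as `(y - k) - (p + j + 1)`. The first part
    -- raises the falling power by one.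
    have hmul : ∀ j ∈ Finset.range n, c p j * fall y (n - (j + 1)) * (y - (n + p : ℕ)) =
        c p j * fall y (n - j) - (p + j + 1 : ℕ) * c p j * fall y (n - (j + 1)) := by
      intro j hj
      rw [Finset.mem_range] at hj
      obtain ⟨k, rfl⟩ : ∃ k, n = k + (j + 1) := ⟨n - (j + 1), by omega⟩
      have e1 : k + (j + 1) - j = k + 1 := by omega
      rw [e1, Nat.add_sub_cancel, fall_succ]
      push_cast
      ring
    -- The term `j = 0` is the overflow `y^{↓n}`, outside the basis; it is rewritten below by `h0`.
    have htel : ∑ j ∈ Finset.range n, c p j * fall y (n - j) =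
        ∑ j ∈ Finset.range n, c p (j + 1) * fall y (n - (j + 1)) + c p 0 * fall y n := by
      have := Finset.sum_range_succ (fun j => c p j * fall y (n - j)) n
      rw [Finset.sum_range_succ', hcn, zero_mul, add_zero] at this
      exact this.symm
    rw [fall_succ, hp, Finset.sum_mul, Finset.sum_congr rfl hmul, Finset.sum_sub_distrib, htel,
      h0, Finset.mul_sum] at hp1
    simp only [add_mul, sub_mul, Finset.sum_add_distrib, Finset.sum_sub_distrib]
    rw [← hp1]
    simp only [mul_assoc]
    ring
  -- Every term of `hd` carries the sign `(-1)^q` up to a constant sign; a second factor `(-1)^q`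
  -- removes it.
  have hs : ((-1 : MvPolynomial (Fin n) ℂ) ^ q) * (-1) ^ q = 1 := by
    rw [← mul_pow]; simp
  simp only [hc, pow_succ, pow_zero] at hd
  linear_combination (-1) ^ q * hd - (level n (shiftedSchur (hook (p + 1) q)) +
    level n (shiftedSchur (hook p (q + 1))) +
    ((p + q + 1 : ℕ) : MvPolynomial (Fin n) ℂ) * level n (shiftedSchur (hook p q)) -
    level n (shiftedSchur (hook p 0)) * level n (shiftedSchur (hook 0 q))) * hs

theorem Fs_hook_recurrence (p q : ℕ) :
    Fs (hook (p + 1) q) + Fs (hook p (q + 1)) + ((p + q + 1 : ℕ) : Lam) * Fs (hook p q) =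
      Fs (hook p 0) * Fs (hook 0 q) := by
  simp only [Fs]
  rw [← map_natCast phi, ← map_mul, ← map_mul, ← map_add, ← map_add]
  congr 1
  apply level_ext
  intro n
  -- The recurrence is available only in more than `q` variables. Smaller levels follow by
  -- specialization.
  refine level_eq_of_le (le_max_left n (q + 1)) ?_
  simp only [map_add, map_mul, map_natCast]
  exact level_hook_recurrence _ p q (le_max_right n (q + 1))

theorem shiftedSchur_empty : shiftedSchur (rowDiagram 0) = 1 := by
  apply level_ext
  intro n
  -- `rowDiagram_colLen` only bounds the number of rows by `1`, so at least one variable is taken.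
  refine level_eq_of_le (Nat.le_succ n) ?_
  have h := level_shiftedSchur_mul (rowDiagram 0) (n + 1) ((rowDiagram_colLen 0).trans (by omega))
  have h0 : (rowDiagram 0).rowLen = fun _ => 0 := by rw [rowDiagram_rowLen]; simp
  rw [h0] at h
  rw [map_one]
  exact mul_right_cancel₀ (alternant_zero_degree (n + 1)).1 (h.trans (one_mul _).symm)

theorem Fs_empty : Fs (rowDiagram 0) = 1 := by
  rw [Fs, shiftedSchur_empty, map_one]

/-! ### The expansion of `H(u)` in Frobenius–Schur functions -/

/-- Over a domain `1 - a/u` is cancellable, so `1/(u - a)` can be recognized by its defining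
equation. -/
theorem invLin_eq_of_mul {R : Type*} [CommRing R] [IsDomain R] [Algebra ℂ R] (a : ℂ)
    (f : PowerSeries R)
    (hf : f * (1 - PowerSeries.C (algebraMap ℂ R a) * PowerSeries.X) = PowerSeries.X) :
    f = invLin a := by
  refine mul_right_cancel₀ (fun h0 => ?_) (hf.trans (invLin_mul a).symm)
  have := congrArg PowerSeries.constantCoeff h0
  simp at this

theorem translate_invLin (a : ℂ) : translate (1 / 2) (invLin a) = invLin (a - 1 / 2) := by
  have hs := hasSubst_invLin (R := Lam) (-(1 / 2))
  apply invLin_eq_of_mul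
  have h1 := invLin_mul (R := Lam) (-(1 / 2))
  have h2 := congrArg (PowerSeries.substAlgHom (R := Lam) hs) (invLin_mul (R := Lam) a)
  rw [map_mul, map_sub, map_one, map_mul, PowerSeries.substAlgHom_X,
    PowerSeries.coe_substAlgHom] at h2
  have h3 : PowerSeries.subst (invLin (-(1 / 2)) : PowerSeries Lam)
      (PowerSeries.C (algebraMap ℂ Lam a)) = PowerSeries.C (algebraMap ℂ Lam a) :=
    PowerSeries.subst_C _
  rw [h3] at h2
  rw [map_neg, map_neg] at h1
  rw [map_sub, map_sub, translate]
  -- `h2` is the equation of `1/(u - a)` with `1/(u + 1/2)` substituted for `1/u`; the factor `1 +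
  -- 1/(2u)` clears the denominator that this introduces.
  linear_combination (1 + PowerSeries.C (algebraMap ℂ Lam (1 / 2)) * PowerSeries.X) * h2 +
    (1 + PowerSeries.C (algebraMap ℂ Lam a) *
      PowerSeries.subst (invLin (-(1 / 2)) : PowerSeries Lam) (invLin a : PowerSeries Lam)) * h1

/-- The translation by `1/2` moves the roots `j + 1/2` to `j`. -/
theorem translate_invHalf (k : ℕ) :
    translate (1 / 2) (invHalf k) = (invFall k : PowerSeries Lam) := by
  have hs := hasSubst_invLin (R := Lam) (-(1 / 2))
  rw [translate, ← PowerSeries.coe_substAlgHom (R := Lam) hs, invHalf, map_prod, invFall]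
  refine Finset.prod_congr rfl fun j _ => ?_
  rw [PowerSeries.coe_substAlgHom]
  refine (translate_invLin _).trans ?_
  congr 1
  ring

theorem X_pow_dvd_invHalf (k : ℕ) : PowerSeries.X ^ k ∣ invHalf k := by
  have := Finset.prod_dvd_prod_of_dvd (s := Finset.range k)
    (fun _ => (PowerSeries.X : PowerSeries Lam)) (fun j : ℕ => invLin ((2 * (j : ℂ) + 1) / 2))
    (fun j _ => Dvd.intro _ rfl)
  rw [invHalf]
  simpa using this

/-- After translation by `1/2`, which is injective, the right side becomes `φ` applied to the
defining expansion of `H*(u)`, and the left side is `H(u + 1/2)`. -/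
theorem H_eq : H = formalSum fun k => PowerSeries.C (Fs (rowDiagram k)) * invHalf k := by
  have hs := hasSubst_invLin (R := Lam) (-(1 / 2))
  have ht : ∀ f, translate (1 / 2) f = PowerSeries.substAlgHom (R := Lam) hs f := fun f => by
    rw [PowerSeries.coe_substAlgHom]; rfl
  apply translate_injective
  rw [← phi_HStar]
  -- Infinite formal sums are avoided by working modulo `X ^ m`, where finite sums suffice. Both
  -- remainders stay divisible by `X ^ m`, since the translation sends `X` to a multiple of `X`.
  apply eq_of_dvd_all
  intro m
  obtain ⟨g, hg⟩ := dvd_formalSum_sub (fun k => PowerSeries.C (hStar k) * invFall k)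
    (fun k => Dvd.dvd.mul_left (X_pow_dvd_invFall k) _) m
  obtain ⟨g', hg'⟩ := dvd_formalSum_sub (fun k => PowerSeries.C (Fs (rowDiagram k)) * invHalf k)
    (fun k => Dvd.dvd.mul_left (X_pow_dvd_invHalf k) _) m
  rw [sub_eq_iff_eq_add] at hg hg'
  have hsum : PowerSeries.map (phi : ShiftedSym →+* Lam)
      (∑ k ∈ Finset.range m, PowerSeries.C (hStar k) * invFall k) =
      translate (1 / 2) (∑ k ∈ Finset.range m, PowerSeries.C (Fs (rowDiagram k)) * invHalf k) := by
    rw [ht, map_sum, map_sum]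
    refine Finset.sum_congr rfl fun k _ => ?_
    rw [map_mul, map_mul, PowerSeries.map_C, ← ht (invHalf k), translate_invHalf,
      PowerSeries.coe_substAlgHom]
    congr 1
    · exact (PowerSeries.subst_C _).symm
    · exact map_invFall (phi : ShiftedSym →ₐ[ℂ] Lam) k
  rw [HStar, hg, hg', map_add, ht, map_add, ← ht (∑ k ∈ Finset.range m, _), hsum,
    add_sub_add_right_eq_sub, map_mul, map_mul, map_pow, map_pow, PowerSeries.map_X, PowerSeries.substAlgHom_X]
  refine dvd_sub (dvd_mul_right _ _) (Dvd.dvd.mul_right (pow_dvd_pow_of_dvd ?_ m) _)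
  exact Dvd.intro _ rfl

/-! ### The generating series of hooks -/

/-- If `a_k` is the inverse of the product of the first `k` factors, then `a_k = (u - k - 1/2)
a_{k+1}`. Multiplying by `1/u` keeps both sides power series in `1/u`. -/
theorem X_mul_invHalf (k : ℕ) : PowerSeries.X * invHalf k = invHalf (k + 1) -
    PowerSeries.C (C ((2 * (k : ℂ) + 1) / 2)) * PowerSeries.X * invHalf (k + 1) := by
  have h := invLin_mul (R := Lam) ((2 * (k : ℂ) + 1) / 2)
  have h1 : invHalf (k + 1) = invHalf k * invLin ((2 * (k : ℂ) + 1) / 2) :=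
    Finset.prod_range_succ _ _
  rw [algebraMap_eq] at h
  rw [h1]
  linear_combination -invHalf k * h

/-- The telescoping of the truncated double series. -/
theorem sum_hook_telescope {A : Type*} [CommRing A] (x y : A) (a b α : ℕ → A) (F : ℕ → ℕ → A)
    (ha0 : a 0 = 1) (hb0 : b 0 = 1)
    (ha : ∀ k, x * a k = a (k + 1) - α k * x * a (k + 1))
    (hb : ∀ k, y * b k = b (k + 1) - α k * y * b (k + 1))
    (hα : ∀ p q, α p + α q = (p + q + 1 : ℕ))
    (hF : ∀ p q, F (p + 1) q + F p (q + 1) + (p + q + 1 : ℕ) * F p q = F p 0 * F 0 q) (M : ℕ) :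
    x * y + (x + y) * ∑ p ∈ Finset.range M, ∑ q ∈ Finset.range M, F p q * a (p + 1) * b (q + 1) =
      x * y * ((1 + ∑ p ∈ Finset.range M, F p 0 * a (p + 1)) *
        (1 + ∑ q ∈ Finset.range M, F 0 q * b (q + 1))) -
      x * y * (a M * ∑ q ∈ Finset.range M, F M q * b (q + 1) +
        b M * ∑ p ∈ Finset.range M, F p M * a (p + 1)) := by
  -- With `x = 1/u` and `y = 1/v` one has `x + y = xy(u + v)`, and `u + v = (u - α p) + (v - α q) +
  -- (p + q + 1)`. The first two parts lower an index of `a` or `b`; `hF` rewrites the third.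
  have h1 : ∀ p q, (x + y) * (F p q * a (p + 1) * b (q + 1)) =
      x * y * (F p 0 * a (p + 1) * (F 0 q * b (q + 1))) +
      x * y * ((F p q * a p - F (p + 1) q * a (p + 1)) * b (q + 1)) +
      x * y * ((F p q * b q - F p (q + 1) * b (q + 1)) * a (p + 1)) := by
    intro p q
    linear_combination (-y * F p q * b (q + 1)) * ha p - x * F p q * a (p + 1) * hb q +
      x * y * a (p + 1) * b (q + 1) * F p q * hα p q + x * y * a (p + 1) * b (q + 1) * hF p q
  -- Telescoping in `p`: the lower end, where `a 0 = 1`, completes the product of single sums, and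
  -- the upper end is a boundary term with factor `a M`.
  have h2 : ∑ p ∈ Finset.range M, ∑ q ∈ Finset.range M,
      (F p q * a p - F (p + 1) q * a (p + 1)) * b (q + 1) =
      ∑ q ∈ Finset.range M, F 0 q * b (q + 1) - a M * ∑ q ∈ Finset.range M, F M q * b (q + 1) := by
    rw [Finset.sum_comm, Finset.mul_sum, ← Finset.sum_sub_distrib]
    refine Finset.sum_congr rfl fun q _ => ?_
    rw [← Finset.sum_mul, Finset.sum_range_sub' (fun p => F p q * a p), ha0]
    ring
  have h3 : ∑ p ∈ Finset.range M, ∑ q ∈ Finset.range M,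
      (F p q * b q - F p (q + 1) * b (q + 1)) * a (p + 1) =
      ∑ p ∈ Finset.range M, F p 0 * a (p + 1) - b M * ∑ p ∈ Finset.range M, F p M * a (p + 1) := by
    rw [Finset.mul_sum, ← Finset.sum_sub_distrib]
    refine Finset.sum_congr rfl fun p _ => ?_
    rw [← Finset.sum_mul, Finset.sum_range_sub' (fun q => F p q * b q), hb0]
    ring
  simp only [Finset.mul_sum (Finset.range M) _ (x + y)]
  simp only [h1, Finset.sum_add_distrib, ← Finset.mul_sum]
  rw [h2, h3]
  simp only [← Finset.sum_mul]
  ring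

/-- The series in `1/u, 1/v` without monomials `u^{-i} v^{-j}` such that `i, j < M`. -/
def truncIdeal (M : ℕ) : Ideal Lam2 where
  carrier := {f | ∀ m : Fin 2 →₀ ℕ, m 0 < M → m 1 < M → MvPowerSeries.coeff m f = 0}
  add_mem' := fun hf hg m h0 h1 => by rw [map_add, hf m h0 h1, hg m h0 h1, add_zero]
  zero_mem' := fun m _ _ => map_zero _
  smul_mem' := fun c f hf m h0 h1 => by
    rw [smul_eq_mul, MvPowerSeries.coeff_mul]
    refine Finset.sum_eq_zero fun k hk => ?_
    have h := Finset.HasAntidiagonal.mem_antidiagonal.1 hk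
    have e0 := DFunLike.congr_fun h 0
    have e1 := DFunLike.congr_fun h 1
    rw [Finsupp.add_apply] at e0 e1
    rw [hf k.2 (by omega) (by omega), mul_zero]

theorem eq_of_sub_mem_truncIdeal {f g : Lam2} (h : ∀ M, f - g ∈ truncIdeal M) : f = g := by
  ext1 m
  -- Any `M` exceeding both exponents of the monomial would do.
  have := h (m 0 + m 1 + 1) m (by omega) (by omega)
  rwa [map_sub, sub_eq_zero] at this

theorem X_pow_mul_mem_truncIdeal (s : Fin 2) (M : ℕ) (f : Lam2) :
    MvPowerSeries.X s ^ M * f ∈ truncIdeal M := by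
  refine Ideal.mul_mem_right _ _ fun m h0 h1 => ?_
  refine MvPowerSeries.X_pow_dvd_iff.1 (dvd_refl (MvPowerSeries.X s ^ M : Lam2)) m ?_
  fin_cases s
  · exact h0
  · exact h1

/-- `f(u)` for `s = 0` and `f(v)` for `s = 1`, as a ring homomorphism in `f`. -/
noncomputable def atHom (s : Fin 2) : PowerSeries Lam →ₐ[Lam] Lam2 :=
  PowerSeries.substAlgHom (PowerSeries.HasSubst.X s)

theorem atU_eq (f : PowerSeries Lam) : atU f = atHom 0 f := by
  rw [atU, atHom, PowerSeries.coe_substAlgHom]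

theorem atV_eq (f : PowerSeries Lam) : atV f = atHom 1 f := by
  rw [atV, atHom, PowerSeries.coe_substAlgHom]

theorem atHom_X (s : Fin 2) : atHom s PowerSeries.X = MvPowerSeries.X s :=
  PowerSeries.substAlgHom_X _

theorem atHom_C (s : Fin 2) (c : Lam) : atHom s (PowerSeries.C c) = MvPowerSeries.C c := by
  rw [atHom, PowerSeries.coe_substAlgHom]
  exact PowerSeries.subst_C c

theorem atHom_mem_truncIdeal (s : Fin 2) (M : ℕ) {f : PowerSeries Lam}
    (hf : PowerSeries.X ^ M ∣ f) : atHom s f ∈ truncIdeal M := by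
  obtain ⟨g, rfl⟩ := hf
  rw [map_mul, map_pow, atHom_X]
  exact X_pow_mul_mem_truncIdeal s M _

theorem X_pow_dvd_atHom (s : Fin 2) (M : ℕ) {f : PowerSeries Lam}
    (hf : PowerSeries.X ^ M ∣ f) : MvPowerSeries.X s ^ M ∣ atHom s f := by
  obtain ⟨g, rfl⟩ := hf
  rw [map_mul, map_pow, atHom_X]
  exact dvd_mul_right _ _

/-- The term of index `(p, q)` is divisible by `u^{-(p+1)} v^{-(q+1)}`. Hence, for a coefficient
with both exponents below `M`, enlarging the ranges to `M` adds only zeros. -/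
theorem hookSeries_sub_mem (M : ℕ) :
    hookSeries - ∑ p ∈ Finset.range M, ∑ q ∈ Finset.range M,
      MvPowerSeries.C (Fs (hook p q)) * atHom 0 (invHalf (p + 1)) * atHom 1 (invHalf (q + 1)) ∈
        truncIdeal M := by
  intro m h0 h1
  have hz : ∀ p q, (m 0 < p + 1 ∨ m 1 < q + 1) → MvPowerSeries.coeff m
      (MvPowerSeries.C (Fs (hook p q)) * atHom 0 (invHalf (p + 1)) * atHom 1 (invHalf (q + 1))) =
      0 := by
    rintro p q (h | h)
    · refine MvPowerSeries.X_pow_dvd_iff.1 (Dvd.dvd.mul_right (Dvd.dvd.mul_left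
        (X_pow_dvd_atHom 0 (p + 1) (X_pow_dvd_invHalf _)) _) _) m h
    · refine MvPowerSeries.X_pow_dvd_iff.1 (Dvd.dvd.mul_left
        (X_pow_dvd_atHom 1 (q + 1) (X_pow_dvd_invHalf _)) _) m h
  have hS : MvPowerSeries.coeff m hookSeries = ∑ p ∈ Finset.range (m 0 + 1),
      ∑ q ∈ Finset.range (m 1 + 1), MvPowerSeries.coeff m (MvPowerSeries.C (Fs (hook p q)) *
        atHom 0 (invHalf (p + 1)) * atHom 1 (invHalf (q + 1))) := by
    simp only [← atU_eq, ← atV_eq]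
    rfl
  rw [map_sub, hS, map_sum, sub_eq_zero]
  have hin : ∀ p, MvPowerSeries.coeff m (∑ q ∈ Finset.range M, MvPowerSeries.C (Fs (hook p q)) *
        atHom 0 (invHalf (p + 1)) * atHom 1 (invHalf (q + 1))) =
      ∑ q ∈ Finset.range (m 1 + 1), MvPowerSeries.coeff m (MvPowerSeries.C (Fs (hook p q)) *
        atHom 0 (invHalf (p + 1)) * atHom 1 (invHalf (q + 1))) := by
    intro p
    rw [map_sum]
    symm
    refine Finset.sum_subset (Finset.range_mono h1) fun q _ hq => hz p q ?_
    rw [Finset.mem_range] at hq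
    omega
  simp only [hin]
  refine Finset.sum_subset (Finset.range_mono h0) fun p _ hp => Finset.sum_eq_zero fun q _ =>
    hz p q ?_
  rw [Finset.mem_range] at hp
  omega

/-- The series `1 + ∑_q Fs_{(0|q)} / ((v - 1/2) ⋯ (v - (2q+1)/2))`. -/
noncomputable def columnSeries : PowerSeries Lam :=
  formalSum fun k => PowerSeries.C (if k = 0 then 1 else Fs (hook 0 (k - 1))) * invHalf k

theorem atHom_formalSum_sub_mem (s : Fin 2) (c : ℕ → Lam) (hc : c 0 = 1) (M : ℕ) :
    atHom s (formalSum fun k => PowerSeries.C (c k) * invHalf k) -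
      (1 + ∑ p ∈ Finset.range M, MvPowerSeries.C (c (p + 1)) * atHom s (invHalf (p + 1))) ∈
        truncIdeal M := by
  -- The cut is at `M + 1` because the term `k = 0` is split off as the constant `1`, leaving `k = p
  -- + 1` with `p < M`.
  have h := dvd_formalSum_sub (fun k => PowerSeries.C (c k) * invHalf k)
    (fun k => Dvd.dvd.mul_left (X_pow_dvd_invHalf k) _) (M + 1)
  have h2 := atHom_mem_truncIdeal s M ((pow_dvd_pow _ (Nat.le_succ M)).trans h)
  have h0 : invHalf 0 = 1 := rfl
  rw [map_sub, map_sum, Finset.sum_range_succ', hc, h0, map_one, one_mul, map_one, add_comm _ 1]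
    at h2
  simpa only [map_mul, atHom_C] using h2

/-- The limit of `sum_hook_telescope` as `M` grows: the boundary terms contain `invHalf M` in `u` or
in `v`, so they lie in `truncIdeal M`. -/
theorem hookSeries_mul : MvPowerSeries.X 0 * MvPowerSeries.X 1 +
    (MvPowerSeries.X 0 + MvPowerSeries.X 1) * hookSeries =
      MvPowerSeries.X 0 * MvPowerSeries.X 1 * (atHom 0 H * atHom 1 columnSeries) := by
  apply eq_of_sub_mem_truncIdeal
  intro M
  have hx : ∀ s k, MvPowerSeries.X s * atHom s (invHalf k) = atHom s (invHalf (k + 1)) -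
      MvPowerSeries.C (C ((2 * (k : ℂ) + 1) / 2)) * MvPowerSeries.X s *
        atHom s (invHalf (k + 1)) := by
    intro s k
    have := congrArg (atHom s) (X_mul_invHalf k)
    simpa only [map_mul, map_sub, atHom_C, atHom_X] using this
  have ht := sum_hook_telescope (MvPowerSeries.X 0 : Lam2) (MvPowerSeries.X 1)
    (fun k => atHom 0 (invHalf k)) (fun k => atHom 1 (invHalf k))
    (fun k => MvPowerSeries.C (C ((2 * (k : ℂ) + 1) / 2)))
    (fun p q => MvPowerSeries.C (Fs (hook p q))) (map_one _) (map_one _) (hx 0) (hx 1)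
    -- The halves add up: `(2p + 1)/2 + (2q + 1)/2 = p + q + 1`, the coefficient in the recurrence.
    (fun p q => by
      rw [← map_add, ← map_add, ← map_natCast (MvPowerSeries.C (σ := Fin 2) (R := Lam)),
        ← map_natCast (C (σ := ℕ+) (R := ℂ))]
      congr 2
      push_cast
      ring)
    (fun p q => by
      rw [← map_natCast (MvPowerSeries.C (σ := Fin 2) (R := Lam)), ← map_mul, ← map_mul, ← map_add,
        ← map_add, Fs_hook_recurrence]) M
  have hS := hookSeries_sub_mem M
  have hH := atHom_formalSum_sub_mem 0 (fun k => Fs (rowDiagram k)) Fs_empty M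
  have hE := atHom_formalSum_sub_mem 1
    (fun k => if k = 0 then 1 else Fs (hook 0 (k - 1))) (if_pos rfl) M
  have ha := atHom_mem_truncIdeal 0 M (X_pow_dvd_invHalf M)
  have hb := atHom_mem_truncIdeal 1 M (X_pow_dvd_invHalf M)
  -- The hook `(p|0)` is the row of length `p + 1`, so the truncation of `H` is the row factor in
  -- `ht`.
  rw [← H_eq] at hH
  simp only [← hook_zero] at hH
  simp only [Nat.add_eq_zero_iff, one_ne_zero, and_false, if_false, Nat.add_sub_cancel] at hE
  change atHom 1 columnSeries - _ ∈ _ at hE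
  set T := ∑ p ∈ Finset.range M, ∑ q ∈ Finset.range M,
      MvPowerSeries.C (Fs (hook p q)) * atHom 0 (invHalf (p + 1)) * atHom 1 (invHalf (q + 1))
  set P := 1 + ∑ p ∈ Finset.range M, MvPowerSeries.C (Fs (hook p 0)) * atHom 0 (invHalf (p + 1))
  set Q := 1 + ∑ q ∈ Finset.range M, MvPowerSeries.C (Fs (hook 0 q)) * atHom 1 (invHalf (q + 1))
  set B := ∑ q ∈ Finset.range M, MvPowerSeries.C (Fs (hook M q)) * atHom 1 (invHalf (q + 1))
  set B' := ∑ p ∈ Finset.range M, MvPowerSeries.C (Fs (hook p M)) * atHom 0 (invHalf (p + 1))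
  -- The error is split into pieces of `truncIdeal M`: the tail of the double series, the two tails
  -- of the product written as `H C - P Q = C (H - P) + P (C - Q)` with `C` the column series in
  -- `v`, and the two boundary terms.
  have key : MvPowerSeries.X 0 * MvPowerSeries.X 1 +
      (MvPowerSeries.X 0 + MvPowerSeries.X 1) * hookSeries -
      MvPowerSeries.X 0 * MvPowerSeries.X 1 * (atHom 0 H * atHom 1 columnSeries) =
      (MvPowerSeries.X 0 + MvPowerSeries.X 1) * (hookSeries - T) -
      MvPowerSeries.X 0 * MvPowerSeries.X 1 * atHom 1 columnSeries * (atHom 0 H - P) -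
      MvPowerSeries.X 0 * MvPowerSeries.X 1 * P * (atHom 1 columnSeries - Q) -
      MvPowerSeries.X 0 * MvPowerSeries.X 1 * B * atHom 0 (invHalf M) -
      MvPowerSeries.X 0 * MvPowerSeries.X 1 * B' * atHom 1 (invHalf M) := by
    linear_combination ht
  rw [key]
  exact sub_mem (sub_mem (sub_mem (sub_mem (Ideal.mul_mem_left _ _ hS) (Ideal.mul_mem_left _ _ hH))
    (Ideal.mul_mem_left _ _ hE)) (Ideal.mul_mem_left _ _ ha)) (Ideal.mul_mem_left _ _ hb)

/-! ### Duality of `H(u)` and `E(v)` -/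

theorem hasSubst_neg_X : PowerSeries.HasSubst (-PowerSeries.X : PowerSeries Lam) := by
  apply PowerSeries.HasSubst.of_constantCoeff_zero'
  simp

theorem subst_neg_X_comp (f : PowerSeries Lam) :
    PowerSeries.subst (-PowerSeries.X : PowerSeries Lam)
      (PowerSeries.subst (-PowerSeries.X : PowerSeries Lam) f) = f := by
  have hs := hasSubst_neg_X
  have h : PowerSeries.subst (-PowerSeries.X : PowerSeries Lam) (-PowerSeries.X : PowerSeries Lam) =
      PowerSeries.X := by
    rw [← PowerSeries.coe_substAlgHom (R := Lam) hs, map_neg, PowerSeries.substAlgHom_X, neg_neg]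
  rw [PowerSeries.subst_comp_subst_apply hs hs, h, PowerSeries.X_subst]

/-- At `v = -u` the factor `1/u + 1/v` vanishes and annihilates the whole hook series, leaving only
the product. -/
theorem H_mul_columnSeries :
    H * PowerSeries.subst (-PowerSeries.X : PowerSeries Lam) columnSeries = 1 := by
  set x : Fin 2 → PowerSeries Lam := fun s => if s = 0 then PowerSeries.X else -PowerSeries.X
  have hx : MvPowerSeries.HasSubst x := by
    apply MvPowerSeries.hasSubst_of_constantCoeff_zero
    intro s
    change PowerSeries.constantCoeff (x s) = 0
    simp only [x]
    split_ifs <;> simp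
  -- Specializing `f(u)` and `f(v)` at `v = -u` gives `f(u)` and `f(-u)`.
  have hcomp : ∀ s f, MvPowerSeries.substAlgHom (R := Lam) hx (atHom s f) =
      PowerSeries.subst (x s) f := by
    intro s f
    rw [atHom, PowerSeries.coe_substAlgHom, MvPowerSeries.coe_substAlgHom, PowerSeries.subst,
      MvPowerSeries.subst_comp_subst_apply (PowerSeries.HasSubst.X s).const hx]
    simp only [MvPowerSeries.subst_X hx]
    rfl
  have h := congrArg (MvPowerSeries.substAlgHom (R := Lam) hx) hookSeries_mul
  have h0 : x 0 = PowerSeries.X := rfl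
  have h1 : x 1 = -PowerSeries.X := rfl
  simp only [map_add, map_mul, hcomp, MvPowerSeries.substAlgHom_X, h0, h1, add_neg_cancel,
    zero_mul, add_zero, PowerSeries.X_subst] at h
  have hne : (PowerSeries.X * -PowerSeries.X : PowerSeries Lam) ≠ 0 :=
    mul_ne_zero PowerSeries.X_ne_zero (neg_ne_zero.2 PowerSeries.X_ne_zero)
  apply mul_left_cancel₀ hne
  rw [mul_one]
  exact h.symm

/-- Under `u ↦ -u` the exponent of `E` becomes minus the exponent of `H`, since `(-1)^(k-1) (-1)^k =
-1`; then `exp(L) exp(-L) = 1`. -/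
theorem H_mul_E : H * PowerSeries.subst (-PowerSeries.X : PowerSeries Lam) E = 1 := by
  set L : PowerSeries Lam := PowerSeries.mk fun k =>
    if hk : 0 < k then C (1 / (k : ℂ)) * X ⟨k, hk⟩ else 0 with hL
  set L' : PowerSeries Lam := PowerSeries.mk fun k =>
    if hk : 0 < k then C ((-1) ^ (k - 1) / (k : ℂ)) * X ⟨k, hk⟩ else 0 with hL'
  have hs : PowerSeries.HasSubst L := by
    apply PowerSeries.HasSubst.of_constantCoeff_zero'
    simp [hL]
  have hs' : PowerSeries.HasSubst L' := by
    apply PowerSeries.HasSubst.of_constantCoeff_zero'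
    simp [hL']
  -- In this form the substitution is a rescaling, whose coefficients can be read off.
  have hneg : (-PowerSeries.X : PowerSeries Lam) = (-1 : Lam) • PowerSeries.X := by simp
  have hLL : PowerSeries.subst (-PowerSeries.X : PowerSeries Lam) L' = -L := by
    rw [hneg, ← PowerSeries.rescale_eq_subst]
    ext1 k
    rw [PowerSeries.coeff_rescale, map_neg, hL, hL', PowerSeries.coeff_mk, PowerSeries.coeff_mk]
    split_ifs with hk
    · obtain ⟨j, rfl⟩ : ∃ j, k = j + 1 := ⟨k - 1, by omega⟩
      have h1 : (-1 : Lam) ^ (j + 1) = C ((-1) ^ (j + 1)) := by simp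
      rw [h1, ← mul_assoc, ← C_mul, ← neg_mul, ← C_neg, Nat.add_sub_cancel]
      congr 2
      have h2 : ((-1 : ℂ) ^ j) * (-1) ^ j = 1 := by rw [← mul_pow]; simp
      rw [pow_succ]
      linear_combination (-1 / ((j + 1 : ℕ) : ℂ)) * h2
    · simp
  have hexp := congrArg (PowerSeries.substAlgHom (R := Lam) hs)
    (PowerSeries.exp_mul_exp_neg_eq_one (A := Lam))
  rw [PowerSeries.evalNegHom, PowerSeries.rescale_eq_subst, ← hneg, map_mul, map_one,
    PowerSeries.coe_substAlgHom, PowerSeries.subst_comp_subst_apply hasSubst_neg_X hs] at hexp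
  have h1 : PowerSeries.subst L (-PowerSeries.X : PowerSeries Lam) = -L := by
    rw [← PowerSeries.coe_substAlgHom (R := Lam) hs, map_neg, PowerSeries.substAlgHom_X]
  rw [h1] at hexp
  rw [E, PowerSeries.subst_comp_subst_apply hs' hasSubst_neg_X, hLL]
  exact hexp

/-- Both series, taken at `-u`, are inverse to `H(u)`; the sign change is an involution, so it can
be undone. -/
theorem columnSeries_eq_E : columnSeries = E := by
  have h : PowerSeries.subst (-PowerSeries.X : PowerSeries Lam) columnSeries =
      PowerSeries.subst (-PowerSeries.X : PowerSeries Lam) E :=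
    left_inv_eq_right_inv ((mul_comm _ _).trans H_mul_columnSeries) H_mul_E
  rw [← subst_neg_X_comp columnSeries, h, subst_neg_X_comp]

end FrobeniusSchur

/-! ### Return from power series in `1/u, 1/v` to the ring containing `u` and `v` -/

theorem theorem2p3 :
    (1 + (FrobeniusSchur.u + FrobeniusSchur.v) *
        FrobeniusSchur.incl FrobeniusSchur.hookSeries =
      FrobeniusSchur.incl
        (FrobeniusSchur.atU FrobeniusSchur.H * FrobeniusSchur.atV FrobeniusSchur.E)) ∧
    ∀ p q : ℕ,
      FrobeniusSchur.Fs (FrobeniusSchur.hook (p + 1) q) +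
          FrobeniusSchur.Fs (FrobeniusSchur.hook p (q + 1)) +
          ((p + q + 1 : ℕ) : FrobeniusSchur.Lam) * FrobeniusSchur.Fs (FrobeniusSchur.hook p q) =
        FrobeniusSchur.Fs (FrobeniusSchur.hook p 0) *
          FrobeniusSchur.Fs (FrobeniusSchur.hook 0 q) := by
  refine ⟨?_, FrobeniusSchur.Fs_hook_recurrence⟩
  have h := congrArg FrobeniusSchur.incl FrobeniusSchur.hookSeries_mul
  rw [FrobeniusSchur.columnSeries_eq_E, ← FrobeniusSchur.atU_eq, ← FrobeniusSchur.atV_eq,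
    map_add, map_mul, map_mul, map_add, map_mul, map_mul] at h
  have hu := FrobeniusSchur.u_mul
  have hv := FrobeniusSchur.v_mul
  -- Only `u x = 1`, `v y = 1` and `xy + (x + y) S = xy P` matter now; multiplying the last by `uv`
  -- gives the claim.
  generalize FrobeniusSchur.incl FrobeniusSchur.hookSeries = S at h ⊢
  generalize FrobeniusSchur.incl (_ * _) = P at h ⊢
  generalize FrobeniusSchur.incl (MvPowerSeries.X 0) = x at h hu
  generalize FrobeniusSchur.incl (MvPowerSeries.X 1) = y at h hv
  generalize FrobeniusSchur.u = u at h hu ⊢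
  generalize FrobeniusSchur.v = v at h hv ⊢
  linear_combination u * v * h - (v * y + v * S - v * y * P) * hu - (1 + u * S - P) * hv
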